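/- Let $n\ge 1$ and let $V_0^n=\{x\in\mathbb R^n: x_1+\cdots+x_n=0\}$. An ordered set partition of $J\subseteq\{1,\ldots,n\}$ is a sequence $(S_1,\ldots,S_m)$ of nonempty pairwise disjoint sets with union $J$; its plate $[S_1,\ldots,S_m]$ is the cone of all $x\in V_0^n$ with $x_i=0$ for $i\notin J$ and $\sum_{i\in S_1\cup\cdots\cup S_j}x_i\ge 0$ for $1\le j\le m-1$. A composite set partition of $\{1,\ldots,n\}$ is a set $\{\mathbf S_1,\ldots,\mathbf S_k\}$ (with $k$ parts) where $\mathbf S_i$ is an ordered set partition of $J_i$ and $\{J_1,\ldots,J_k\}$ is a set partition of $\{1,\ldots,n\}$; it is standard if, for each $i$, the first block of $\mathbf S_i$ contains $\min J_i$. It labels the Minkowski sum of the plates of $\mathbf S_1,\ldots,\mathbf S_k$. A cone is pointed if it contains no doubly infinite line. Let $\hat{\mathcal P}^n$ be the complex linear span of the characteristic functions of all plates labelled by ordered set partitions of $\{1,\ldots,n\}$, and let $\hat{\mathcal P}_1^n$ be its quotient by the span of the characteristic functions of those plates that are not pointed. Let the degree-$k$ component $(\hat{\mathcal P}^n)_k$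 be the span of the characteristic functions in $\hat{\mathcal P}^n$ of the Minkowski sums labelled by standard composite set partitions of $\{1,\ldots,n\}$ with $k$ parts, and let $(\hat{\mathcal P}_1^n)_k$ be the span of the classes of those among these functions whose Minkowski sum is pointed. Let $S(n,i)$ be the number of set partitions of $\{1,\ldots,n\}$ into $i$ blocks, and $s(i,k)$ the number of permutations of $\{1,\ldots,i\}$ with exactly $k$ disjoint cycles (fixed points included). Then $\hat{\mathcal P}^n=\bigoplus_{k\ge 0}(\hat{\mathcal P}^n)_k$ and, for every $k\ge 0$, the dimension of $(\hat{\mathcal P}^n)_k$ is the number of standard composite set partitions of $\{1,\ldots,n\}$ with $k$ parts, namely $$\dim(\hat{\mathcal P}^n)_k=\sum_{i=k}^n S(n,i)\,s(i,k).$$ Likewise $\hat{\mathcal P}_1^n=\bigoplus_{k\ge 0}(\hat{\mathcal P}_1^n)_k$ and, for every $k\ge 0$, $$\dim(\hat{\mathcal P}_1^n)_k=S(n,n)\,s(n,k)=s(n,k).$$ -/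

import Mathlib

noncomputable section

namespace Plates

open scoped Pointwise

/-- An ordered set partition `(S₁, …, S_m)` of a subset `J` of the `n`-element index set: a finite
sequence of nonempty, pairwise disjoint blocks whose union is `J`. -/
@[ext]
structure OrderedSetPartition {n : ℕ} (J : Finset (Fin n)) where
  blocks : List (Finset (Fin n))
  nonempty_of_mem : ∀ S ∈ blocks, S.Nonempty
  pairwise_disjoint : blocks.Pairwise Disjoint
  mem_iff : ∀ a, a ∈ J ↔ ∃ S ∈ blocks, a ∈ S

namespace OrderedSetPartition

variable {n : ℕ} {J : Finset (Fin n)}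

/-- The plate `[S₁, …, S_m]`: the cone of all `x ∈ ℝⁿ` supported on `J`, with coordinate sum zero,
such that the sum of the `x i` over `i ∈ S₁ ∪ ⋯ ∪ S_j` is nonnegative for each `j < m`. -/
def plate (π : OrderedSetPartition J) : Set (Fin n → ℝ) :=
  {x | (∀ i, i ∉ J → x i = 0) ∧ ∑ i, x i = 0 ∧
    ∀ j < π.blocks.length, 0 ≤ ∑ i ∈ (π.blocks.take j).toFinset.biUnion id, x i}

/-- The first block contains the smallest element of `J`. -/
def IsStandard (π : OrderedSetPartition J) : Prop :=
  ∃ S, π.blocks.head? = some S ∧ ∃ a ∈ S, ∀ b ∈ J, a ≤ b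

end OrderedSetPartition

/-- A composite set partition of the `n`-element index set: an unordered set partition
`{J₁, …, J_l}` together with an ordered set partition of each `J_i`. -/
structure CompositeSetPartition (n : ℕ) where
  supports : Finpartition (Finset.univ : Finset (Fin n))
  part : ∀ J : {J // J ∈ supports.parts}, OrderedSetPartition J.1

namespace CompositeSetPartition

variable {n : ℕ}

/-- The number `l` of ordered set partitions in the composite set partition. -/
def numParts (c : CompositeSetPartition n) : ℕ := c.supports.parts.card

/-- Every constituent ordered set partition is standard. -/
def IsStandard (c : CompositeSetPartition n) : Prop := ∀ J, (c.part J).IsStandard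

/-- The Minkowski sum of the plates of the constituents. -/
def cone (c : CompositeSetPartition n) : Set (Fin n → ℝ) :=
  ∑ J : {J // J ∈ c.supports.parts}, (c.part J).plate

end CompositeSetPartition

/-- The complex-valued characteristic function of a subset of `ℝⁿ`. -/
def charFun {n : ℕ} (C : Set (Fin n → ℝ)) : (Fin n → ℝ) → ℂ := C.indicator 1

/-- A cone is pointed if it contains no line extending to infinity in both directions. -/
def IsPointed {n : ℕ} (C : Set (Fin n → ℝ)) : Prop :=
  ¬ ∃ x v : Fin n → ℝ, v ≠ 0 ∧ ∀ t : ℝ, x + t • v ∈ C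

/-- The complex span of the characteristic functions of all plates `[S₁, …, S_m]` labelled by
ordered set partitions of the whole index set. -/
def plateSpace (n : ℕ) : Submodule ℂ ((Fin n → ℝ) → ℂ) :=
  Submodule.span ℂ
    {f | ∃ π : OrderedSetPartition (Finset.univ : Finset (Fin n)), f = charFun π.plate}

/-- The span of the characteristic functions of the plates that are not pointed. -/
def nonpointedSpace (n : ℕ) : Submodule ℂ (plateSpace n) :=
  Submodule.span ℂ
    {f | ∃ π : OrderedSetPartition (Finset.univ : Finset (Fin n)),
      ¬ IsPointed π.plate ∧ (f : (Fin n → ℝ) → ℂ) = charFun π.plate}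

/-- The space of plates modulo the nonpointed plates. -/
abbrev PointedPlateSpace (n : ℕ) : Type := plateSpace n ⧸ nonpointedSpace n

/-- The degree `k` component of the space of plates: the span of the characteristic functions of
the Minkowski sums of plates labelled by standard composite set partitions with `k` parts. -/
def degreeComponent (n k : ℕ) : Submodule ℂ (plateSpace n) :=
  Submodule.span ℂ
    {f | ∃ c : CompositeSetPartition n, c.IsStandard ∧ c.numParts = k ∧
      (f : (Fin n → ℝ) → ℂ) = charFun c.cone}

/-- The degree `k` component of the quotient: the span of the classes of the characteristic
functions of the pointed Minkowski sums of plates labelled by standard composite set partitions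
with `k` parts. -/
def pointedDegreeComponent (n k : ℕ) : Submodule ℂ (PointedPlateSpace n) :=
  Submodule.span ℂ
    {g | ∃ (f : plateSpace n) (c : CompositeSetPartition n),
      c.IsStandard ∧ c.numParts = k ∧ IsPointed c.cone ∧
      (f : (Fin n → ℝ) → ℂ) = charFun c.cone ∧ g = (nonpointedSpace n).mkQ f}

/-- The Stirling number of the second kind: the number of set partitions of an `n`-element set
into `i` blocks. -/
def stirlingSnd (n i : ℕ) : ℕ :=
  Nat.card {P : Finpartition (Finset.univ : Finset (Fin n)) // P.parts.card = i}

/-- The unsigned Stirling number of the first kind: the number of permutations of an `i`-element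
set with `k` disjoint cycles, fixed points included (`σ.partition` lists the cycle lengths). -/
def stirlingFst (i k : ℕ) : ℕ :=
  Nat.card {σ : Equiv.Perm (Fin i) // σ.partition.parts.card = k}

end Plates

end

noncomputable section

namespace Plates

open scoped Classical Pointwise

/-! Everything is read off from preorders. A plate, or a Minkowski sum of plates, is cut out of the
hyperplane of coordinate sum zero by the inequalities `0 ≤ ∑ i ∈ A, x i` over the nonempty proper
lower sets `A` of a preorder (`mem_plate_univ_iff`, `mem_cone_iff`). For a plate the preorder is
total, which amounts to a flag of subsets; for a composite it is a disjoint union of total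
preorders. Hence `plateSpace n` is the span of the functions `cutFun` of flags. These are linearly
independent: restricting a relation to lines in the direction `e_i - e_j` isolates the chains that
separate `i` from `j` in a given order, and induction along a flag isolates its coefficient
(`coeff_eq_zero_of_cutFun_relation`).

Inclusion-exclusion replaces this basis by the functions `openFun`, and an Euler characteristic
cancellation (`cutFun_lowerSets`) shows that the cone of any relation is the plain sum of `openFun
σ` over the flags `σ` whose total preorder contains the relation. In this basis all coordinates of
cones are therefore 0 or 1.

Concatenating the components of a standard composite by decreasing least labels gives a weak order,
and cutting a weak order where its prefix minimum drops recovers the composite. So standard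
composites are as numerous as flags. Take the coordinate, at the flag of the concatenation of `c`,
of the cone of `c'`: if it is nonzero, the prefix minima of `c'` are at least those of `c`, and when
they all agree the relation of `c'` is contained in that of `c`. This triangularity
(`IsStandardRel.eq_or_relKey_lt`) makes the cones of standard composites a basis, and grouping it by
the number of parts gives the direct sum.

A cone is pointed exactly when its preorder has no ties. Nonpointed plates have zero coordinate at
flags of linear orders, while cones with ties lie in the span of nonpointed plates; so the classes
of the pointed cones form a basis of the quotient.

For the dimensions, the number of parts is the number of distinct prefix minima of the weak order.
Once the tie classes are fixed, a weak order is a permutation of them and this number counts its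
records. Records and cycles of permutations of `m` elements have the same generating function, the
product of `X + j` over `j < m`. -/

/-- A vanishing combination of half-line
indicators has vanishing coefficient sums. -/
lemma halfLine_relation {κ : Type*} (K₁ K₂ : Finset κ) (c : ℂ) (b d : κ → ℂ) (l u : κ → ℝ)
    (h : ∀ t : ℝ, c + ∑ k ∈ K₁, b k * (if l k ≤ t then 1 else 0) +
      ∑ k ∈ K₂, d k * (if t ≤ u k then 1 else 0) = 0) :
    c = 0 ∧ ∑ k ∈ K₁, b k = 0 := by
  -- Compare the relation at a threshold `v` and just to its right: indicators of `l k ≤ t` are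
  -- right-continuous, so the only jump comes from the `d k` with `u k = v`, whose sum must vanish.
  have hd : ∑ k ∈ K₂, d k = 0 := by
    rw [← Finset.sum_fiberwise_of_maps_to (g := u) (t := K₂.image u)
      (fun k hk => Finset.mem_image_of_mem _ hk)]
    refine Finset.sum_eq_zero fun v _ => ?_
    -- a small step to the right of `v` crosses none of the other thresholds
    obtain ⟨w, hvw, hw⟩ : ∃ w > v, ∀ z ∈ K₁.image l ∪ K₂.image u, v < z → w < z := by
      have : ∀ s : Finset ℝ, ∃ w > v, ∀ z ∈ s, v < z → w < z := by
        intro s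
        induction s using Finset.induction_on with
        | empty => exact ⟨v + 1, by linarith, by simp⟩
        | insert z s _ ih =>
          obtain ⟨w, hvw, hw⟩ := ih
          by_cases hz : v < z
          · refine ⟨min w ((v + z) / 2), lt_min hvw (by linarith), fun y hy hvy => ?_⟩
            rcases Finset.mem_insert.1 hy with rfl | hy
            · exact (min_le_right _ _).trans_lt (by linarith)
            · exact (min_le_left _ _).trans_lt (hw y hy hvy)
          · refine ⟨w, hvw, fun y hy hvy => ?_⟩
            rcases Finset.mem_insert.1 hy with rfl | hy
            · exact absurd hvy hz
            · exact hw y hy hvy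
      exact this _
    have e1 : ∑ k ∈ K₁, b k * (if l k ≤ v then (1 : ℂ) else 0) =
        ∑ k ∈ K₁, b k * (if l k ≤ w then 1 else 0) := by
      refine Finset.sum_congr rfl fun k hk => ?_
      congr 2
      refine propext ⟨fun h => h.trans hvw.le, fun h => ?_⟩
      by_contra! hlt
      exact absurd h (not_le.2 (hw _ (Finset.mem_union_left _ (Finset.mem_image_of_mem _ hk)) hlt))
    have e2 : ∑ k ∈ K₂, d k * (if v ≤ u k then (1 : ℂ) else 0) =
        ∑ k ∈ K₂, d k * (if w ≤ u k then 1 else 0) + ∑ k ∈ K₂ with u k = v, d k := by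
      rw [Finset.sum_filter, ← Finset.sum_add_distrib]
      refine Finset.sum_congr rfl fun k hk => ?_
      rcases lt_trichotomy (u k) v with hlt | heq | hgt
      · rw [if_neg (not_le.2 hlt), if_neg (not_le.2 (hlt.trans hvw)), if_neg hlt.ne]; simp
      · rw [if_pos heq.ge, if_neg (not_le.2 (heq.trans_lt hvw)), if_pos heq]; simp
      · rw [if_pos hgt.le, if_pos (hw _ (Finset.mem_union_right _
          (Finset.mem_image_of_mem _ hk)) hgt).le, if_neg hgt.ne']; simp
    have h1 := h v
    have h2 := h w
    rw [e1, e2] at h1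
    linear_combination h1 - h2
  have hbound : ∀ s : Finset ℝ, ∃ t, ∀ z ∈ s, z < t ∧ -t < z := by
    intro s
    induction s using Finset.induction_on with
    | empty => exact ⟨0, by simp⟩
    | insert z s _ ih =>
      obtain ⟨t, ht⟩ := ih
      refine ⟨max t (|z| + 1), fun y hy => ?_⟩
      rcases Finset.mem_insert.1 hy with rfl | hy
      · have h1 := le_max_right t (|y| + 1)
        have h2 := le_abs_self y
        have h3 := neg_abs_le y
        constructor <;> linarith
      · have h1 := le_max_left t (|z| + 1)
        have := ht y hy
        constructor <;> linarith
  obtain ⟨T, hT⟩ := hbound (K₁.image l ∪ K₂.image u)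
  have hT1 : ∀ k ∈ K₁, l k < T ∧ -T < l k := fun k hk =>
    hT _ (Finset.mem_union_left _ (Finset.mem_image_of_mem _ hk))
  have hT2 : ∀ k ∈ K₂, u k < T ∧ -T < u k := fun k hk =>
    hT _ (Finset.mem_union_right _ (Finset.mem_image_of_mem _ hk))
  have e1 : ∑ k ∈ K₁, b k * (if l k ≤ T then (1 : ℂ) else 0) = ∑ k ∈ K₁, b k :=
    Finset.sum_congr rfl fun k hk => by rw [if_pos (hT1 k hk).1.le, mul_one]
  have e2 : ∑ k ∈ K₂, d k * (if T ≤ u k then (1 : ℂ) else 0) = 0 :=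
    Finset.sum_eq_zero fun k hk => by rw [if_neg (not_le.2 (hT2 k hk).1), mul_zero]
  have e3 : ∑ k ∈ K₁, b k * (if l k ≤ -T then (1 : ℂ) else 0) = 0 :=
    Finset.sum_eq_zero fun k hk => by rw [if_neg (not_le.2 (hT1 k hk).2), mul_zero]
  have e4 : ∑ k ∈ K₂, d k * (if -T ≤ u k then (1 : ℂ) else 0) = ∑ k ∈ K₂, d k :=
    Finset.sum_congr rfl fun k hk => by rw [if_pos (hT2 k hk).2.le, mul_one]
  -- Beyond all thresholds the relation reads `c + ∑ b = 0` on the right and `c + ∑ d = 0` on the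
  -- left.
  have h1 := h T
  have h2 := h (-T)
  rw [e1, e2] at h1
  rw [e3, e4, hd] at h2
  have hc : c = 0 := by simpa using h2
  exact ⟨hc, by simpa [hc] using h1⟩

/-! ### Flags of subsets and total preorders -/

section Flags

variable {ι : Type*}

/-- The preorder attached to a family of subsets. -/
def flagRel (σ : Finset (Finset ι)) (a b : ι) : Prop := ∀ A ∈ σ, b ∈ A → a ∈ A

lemma flagRel_total {σ : Finset (Finset ι)} (h : IsChain (· ⊆ ·) (σ : Set (Finset ι))) (a b : ι) :
    flagRel σ a b ∨ flagRel σ b a := by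
  by_contra! hc
  simp only [flagRel, not_forall] at hc
  obtain ⟨⟨A, hA, hbA, haA⟩, ⟨B, hB, haB, hbB⟩⟩ := hc
  rcases h.total hA hB with hs | hs
  · exact hbB (hs hbA)
  · exact haA (hs haB)

lemma flagRel_trans {σ : Finset (Finset ι)} {a b c : ι} (h : flagRel σ a b) (h' : flagRel σ b c) :
    flagRel σ a c := fun A hA hc => h A hA (h' A hA hc)

variable [Fintype ι]

/-- The cut-out function of a family `σ` of subsets: the characteristic function of the cone of all
`x` of coordinate sum zero all of whose partial sums over members of `σ` are nonnegative. -/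
def cutFun (σ : Finset (Finset ι)) (x : ι → ℝ) : ℂ :=
  if ∑ i, x i = 0 ∧ ∀ A ∈ σ, 0 ≤ ∑ i ∈ A, x i then 1 else 0

/-- The signed characteristic function of the open dual cone. -/
def openFun (σ : Finset (Finset ι)) (x : ι → ℝ) : ℂ :=
  if ∑ i, x i = 0 then ∏ A ∈ σ, (if 0 ≤ ∑ i ∈ A, x i then 0 else -1) else 0

/-- A flag is a chain of nonempty proper subsets. -/
def IsFlag (σ : Finset (Finset ι)) : Prop :=
  IsChain (· ⊆ ·) (σ : Set (Finset ι)) ∧ ∀ A ∈ σ, A.Nonempty ∧ A ≠ Finset.univ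

lemma IsFlag.mono {σ τ : Finset (Finset ι)} (h : IsFlag σ) (hτ : τ ⊆ σ) : IsFlag τ :=
  ⟨h.1.mono (by exact_mod_cast hτ), fun A hA => h.2 A (hτ hA)⟩

/-- The nonempty proper lower sets of a relation. -/
def lowerSets (r : ι → ι → Prop) : Finset (Finset ι) :=
  Finset.univ.filter fun A => A.Nonempty ∧ A ≠ Finset.univ ∧ ∀ a b, r a b → b ∈ A → a ∈ A

lemma mem_lowerSets {r : ι → ι → Prop} {A : Finset ι} : A ∈ lowerSets r ↔
    A.Nonempty ∧ A ≠ Finset.univ ∧ ∀ a b, r a b → b ∈ A → a ∈ A := by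
  simp [lowerSets]

lemma subset_lowerSets_iff {σ : Finset (Finset ι)} (hσ : IsFlag σ) {r : ι → ι → Prop} :
    σ ⊆ lowerSets r ↔ ∀ a b, r a b → flagRel σ a b := by
  constructor
  · intro h a b hab A hA hb
    exact (mem_lowerSets.1 (h hA)).2.2 a b hab hb
  · intro h A hA
    exact mem_lowerSets.2 ⟨(hσ.2 A hA).1, (hσ.2 A hA).2, fun a b hab hb => h a b hab A hA hb⟩

/-- With `flagRel_lowerSets`, this identifies flags with total preorders: a lower set of a total
preorder is determined by a topmost element, and is the smallest member of the flag containing it.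
-/
lemma lowerSets_flagRel {σ : Finset (Finset ι)} (hσ : IsFlag σ) : lowerSets (flagRel σ) = σ := by
  apply Finset.Subset.antisymm
  · intro A hA
    obtain ⟨hne, hpr, hlow⟩ := mem_lowerSets.1 hA
    -- Lying in the fewest members of the flag makes `a` a topmost element of `A`.
    obtain ⟨a, haA, hmin⟩ := Finset.exists_min_image A (fun a => (σ.filter (a ∈ ·)).card) hne
    have hle : ∀ b ∈ A, flagRel σ b a := by
      intro b hb
      rcases flagRel_total hσ.1 b a with h | h
      · exact h
      · have hsub : σ.filter (b ∈ ·) ⊆ σ.filter (a ∈ ·) := by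
          intro C hC
          rw [Finset.mem_filter] at hC ⊢
          exact ⟨hC.1, h C hC.1 hC.2⟩
        have heq := Finset.eq_of_subset_of_card_le hsub (hmin b hb)
        intro C hC haC
        have : C ∈ σ.filter (a ∈ ·) := Finset.mem_filter.2 ⟨hC, haC⟩
        rw [← heq] at this
        exact (Finset.mem_filter.1 this).2
    have hT : (σ.filter (a ∈ ·)).Nonempty := by
      by_contra hT
      rw [Finset.not_nonempty_iff_eq_empty, Finset.filter_eq_empty_iff] at hT
      exact hpr (Finset.eq_univ_iff_forall.2 fun b =>
        hlow b a (fun C hC haC => absurd haC (hT hC)) haA)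
    obtain ⟨C, hC, hCmin⟩ := Finset.exists_min_image _ Finset.card hT
    rw [Finset.mem_filter] at hC
    suffices A = C by rw [this]; exact hC.1
    ext b
    constructor
    · intro hb
      exact hle b hb C hC.1 hC.2
    · intro hb
      refine hlow b a (fun D hD haD => ?_) haA
      rcases hσ.1.total hC.1 hD with h | h
      · exact h hb
      · have := hCmin D (Finset.mem_filter.2 ⟨hD, haD⟩)
        rw [Finset.eq_of_subset_of_card_le h this]
        exact hb
  · exact (subset_lowerSets_iff hσ).2 fun _ _ h => h

lemma isFlag_lowerSets {r : ι → ι → Prop} (ht : ∀ a b, r a b ∨ r b a) : IsFlag (lowerSets r) := by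
  refine ⟨fun A hA B hB _ => ?_, fun A hA => ⟨(mem_lowerSets.1 hA).1, (mem_lowerSets.1 hA).2.1⟩⟩
  by_contra! hc
  obtain ⟨h1, h2⟩ := hc
  obtain ⟨a, haA, haB⟩ := Finset.not_subset.1 h1
  obtain ⟨b, hbB, hbA⟩ := Finset.not_subset.1 h2
  rcases ht a b with h | h
  · exact haB ((mem_lowerSets.1 hB).2.2 a b h hbB)
  · exact hbA ((mem_lowerSets.1 hA).2.2 b a h haA)

lemma flagRel_lowerSets {r : ι → ι → Prop} (hr : ∀ a, r a a)
    (htr : ∀ a b c, r a b → r b c → r a c) {a b : ι} :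
    flagRel (lowerSets r) a b ↔ r a b := by
  constructor
  · intro h
    by_contra hab
    -- Test against the principal lower set of `b`; it is proper because it omits `a`.
    have := h (Finset.univ.filter fun d => r d b) (mem_lowerSets.2
      ⟨⟨b, by simp [hr]⟩, fun hu => hab (by simpa using Finset.eq_univ_iff_forall.1 hu a),
        fun c d hcd hd => by simp at hd ⊢; exact htr _ _ _ hcd hd⟩) (by simp [hr])
    simp at this
    exact hab this
  · intro h A hA hb
    exact (mem_lowerSets.1 hA).2.2 a b h hb

end Flags

/-! ### Linear independence of the cones of flags -/

section Independence

variable {ι : Type*}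

lemma exists_lower_threshold (s : Finset (Finset ι)) (hs : s.Nonempty) (x : ι → ℝ) :
    ∃ l : ℝ, ∀ t, (∀ A ∈ s, 0 ≤ ∑ a ∈ A, x a + t) ↔ l ≤ t := by
  refine ⟨s.sup' hs fun A => -∑ a ∈ A, x a, fun t => ?_⟩
  rw [Finset.sup'_le_iff]
  refine forall₂_congr fun A _ => ⟨fun h => by linarith, fun h => by linarith⟩

/-- The members of `s` not separating `i` from `j`. -/
def unseparated (s : Finset (Finset ι)) (i j : ι) : Finset (Finset ι) :=
  s.filter fun A => i ∈ A ↔ j ∈ A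

variable [Fintype ι]

omit [Fintype ι] in
lemma sum_translate [DecidableEq ι] (x : ι → ℝ) (i j : ι) (t : ℝ) (A : Finset ι) :
    ∑ a ∈ A, (x + t • (Pi.single i 1 - Pi.single j 1 : ι → ℝ)) a =
      ∑ a ∈ A, x a + t * ((if i ∈ A then 1 else 0) - (if j ∈ A then 1 else 0)) := by
  simp only [Pi.add_apply, Pi.smul_apply, Pi.sub_apply, smul_eq_mul, Finset.sum_add_distrib,
    ← Finset.mul_sum, Finset.sum_sub_distrib, Pi.single_apply]
  simp

/-- In a chain with one member containing `i` but not `j`, every member separating the two does so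
in the same sense. Moving by `t` adds `t` to the sums over the separating members and fixes all
others, so the former impose one lower bound on `t` and the latter a constant factor. -/
lemma cutFun_translate_of_left {s : Finset (Finset ι)} (hs : IsChain (· ⊆ ·) (s : Set (Finset ι)))
    {i j : ι} (h : ∃ A ∈ s, i ∈ A ∧ j ∉ A) (x : ι → ℝ) :
    ∃ l : ℝ, ∀ t : ℝ, cutFun s (x + t • (Pi.single i 1 - Pi.single j 1 : ι → ℝ)) =
      cutFun (unseparated s i j) x * (if l ≤ t then 1 else 0) := by
  obtain ⟨A₀, hA₀, hi₀, hj₀⟩ := h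
  obtain ⟨l, hl⟩ := exists_lower_threshold (s.filter fun A => i ∈ A ∧ j ∉ A)
    ⟨A₀, by simp [hA₀, hi₀, hj₀]⟩ x
  refine ⟨l, fun t => ?_⟩
  have hno : ∀ A ∈ s, j ∈ A → i ∈ A := by
    intro A hA hj
    rcases hs.total hA hA₀ with h | h
    · exact absurd (h hj) hj₀
    · exact h hi₀
  simp only [cutFun, ← hl, unseparated, Finset.mem_filter, sum_translate]
  rw [ite_zero_mul_ite_zero, mul_one]
  congr 1
  simp only [Finset.mem_univ, if_true, sub_self, mul_zero, add_zero, and_assoc, eq_iff_iff]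
  refine and_congr_right fun _ => ⟨fun h => ⟨fun A hA => ?_, fun A hA => ?_⟩, fun h A hA => ?_⟩
  · have := h A hA.1
    simpa [hA.2] using this
  · have := h A hA.1
    simpa [hA.2] using this
  · by_cases hi : i ∈ A
    · by_cases hj : j ∈ A
      · simpa [hi, hj] using h.1 A ⟨hA, by simp [hi, hj]⟩
      · simpa [hi, hj] using h.2 A ⟨hA, hi, hj⟩
    · have hj : j ∉ A := fun hj => hi (hno A hA hj)
      simpa [hi, hj] using h.1 A ⟨hA, by simp [hi, hj]⟩

lemma cutFun_translate_of_right {s : Finset (Finset ι)} (hs : IsChain (· ⊆ ·) (s : Set (Finset ι)))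
    {i j : ι} (h : ∃ A ∈ s, j ∈ A ∧ i ∉ A) (x : ι → ℝ) :
    ∃ u : ℝ, ∀ t : ℝ, cutFun s (x + t • (Pi.single i 1 - Pi.single j 1 : ι → ℝ)) =
      cutFun (unseparated s i j) x * (if t ≤ u then 1 else 0) := by
  obtain ⟨l, hl⟩ := cutFun_translate_of_left hs h x
  refine ⟨-l, fun t => ?_⟩
  have h1 : x + t • (Pi.single i 1 - Pi.single j 1 : ι → ℝ) =
      x + (-t) • (Pi.single j 1 - Pi.single i 1) := by
    rw [neg_smul, ← smul_neg, neg_sub]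
  have h2 : unseparated s i j = unseparated s j i := by
    simp only [unseparated, iff_comm]
  rw [h1, hl, h2]
  simp only [le_neg]

lemma cutFun_translate_of_unseparated {s : Finset (Finset ι)} {i j : ι}
    (h : ∀ A ∈ s, i ∈ A ↔ j ∈ A) (x : ι → ℝ) (t : ℝ) :
    cutFun s (x + t • (Pi.single i 1 - Pi.single j 1 : ι → ℝ)) = cutFun s x := by
  simp only [cutFun, sum_translate]
  congr 1
  simp only [Finset.mem_univ, if_true, sub_self, mul_zero, add_zero, eq_iff_iff]
  refine and_congr_right fun _ => forall₂_congr fun A hA => ?_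
  simp [h A hA]

/-- Restricting a linear relation between cut-out functions of chains along a line in the direction
`e_i - e_j`. -/
lemma cutFun_relation {κ : Type*} (K : Finset κ) (a : κ → ℂ) (s : κ → Finset (Finset ι))
    (hs : ∀ k ∈ K, IsChain (· ⊆ ·) (s k : Set (Finset ι)))
    (h : ∀ x, ∑ k ∈ K, a k * cutFun (s k) x = 0) (i j : ι) :
    (∀ x, ∑ k ∈ K with ∀ A ∈ s k, i ∈ A ↔ j ∈ A, a k * cutFun (s k) x = 0) ∧
    ∀ x, ∑ k ∈ K with ∃ A ∈ s k, i ∈ A ∧ j ∉ A, a k * cutFun (unseparated (s k) i j) x = 0 := by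
  rw [← forall_and]
  intro x
  choose! l hl using fun k (hk : k ∈ K ∧ ∃ A ∈ s k, i ∈ A ∧ j ∉ A) =>
    cutFun_translate_of_left (hs k hk.1) hk.2 x
  choose! u hu using fun k (hk : k ∈ K ∧ ∃ A ∈ s k, j ∈ A ∧ i ∉ A) =>
    cutFun_translate_of_right (hs k hk.1) hk.2 x
  refine halfLine_relation (K.filter fun k => ∃ A ∈ s k, i ∈ A ∧ j ∉ A)
    (K.filter fun k => ∃ A ∈ s k, j ∈ A ∧ i ∉ A)
    _ (fun k => a k * cutFun (unseparated (s k) i j) x)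
    (fun k => a k * cutFun (unseparated (s k) i j) x) l u fun t => ?_
  refine Eq.trans ?_ (h (x + t • (Pi.single i 1 - Pi.single j 1 : ι → ℝ)))
  rw [Finset.sum_filter, Finset.sum_filter,
    Finset.sum_filter, ← Finset.sum_add_distrib, ← Finset.sum_add_distrib]
  refine Finset.sum_congr rfl fun k hk => ?_
  by_cases h1 : ∃ A ∈ s k, i ∈ A ∧ j ∉ A
  · have h2 : ¬ ∃ A ∈ s k, j ∈ A ∧ i ∉ A := by
      rintro ⟨B, hB, hjB, hiB⟩
      obtain ⟨A, hA, hiA, hjA⟩ := h1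
      rcases (hs k hk).total hA hB with h | h
      · exact hiB (h hiA)
      · exact hjA (h hjB)
    have h3 : ¬ ∀ A ∈ s k, i ∈ A ↔ j ∈ A := by
      obtain ⟨A, hA, hiA, hjA⟩ := h1
      exact fun h => hjA ((h A hA).1 hiA)
    rw [if_neg h3, if_pos h1, if_neg h2, hl k ⟨hk, h1⟩]
    ring
  · by_cases h2 : ∃ A ∈ s k, j ∈ A ∧ i ∉ A
    · have h3 : ¬ ∀ A ∈ s k, i ∈ A ↔ j ∈ A := by
        obtain ⟨A, hA, hjA, hiA⟩ := h2
        exact fun h => hiA ((h A hA).2 hjA)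
      rw [if_neg h3, if_neg h1, if_pos h2, hu k ⟨hk, h2⟩]
      ring
    · have h3 : ∀ A ∈ s k, i ∈ A ↔ j ∈ A := by
        intro A hA
        push Not at h1 h2
        exact ⟨h1 A hA, h2 A hA⟩
      rw [if_pos h3, if_neg h1, if_neg h2, cutFun_translate_of_unseparated h3]
      ring

/-- Imposes the first half of `cutFun_relation` for one pair after another, discarding the chains
that separate it. -/
lemma cutFun_relation_unseparated {κ : Type*} (K : Finset κ) (a : κ → ℂ)
    (s : κ → Finset (Finset ι)) (hs : ∀ k ∈ K, IsChain (· ⊆ ·) (s k : Set (Finset ι)))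
    (h : ∀ x, ∑ k ∈ K, a k * cutFun (s k) x = 0) (Q : Finset (ι × ι)) (x : ι → ℝ) :
    ∑ k ∈ K with ∀ q ∈ Q, ∀ A ∈ s k, q.1 ∈ A ↔ q.2 ∈ A, a k * cutFun (s k) x = 0 := by
  induction Q using Finset.induction_on generalizing x with
  | empty => simpa using h x
  | insert q Q _ ih =>
    have := (cutFun_relation _ a s (fun k hk => hs k (Finset.mem_filter.1 hk).1) ih q.1 q.2).1 x
    rw [Finset.filter_filter] at this
    rw [← this]
    refine Finset.sum_congr (Finset.filter_congr fun k _ => ?_) fun _ _ => rfl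
    simp only [Finset.forall_mem_insert]
    tauto

/-- In a relation between cut-out functions of chains of sets that are unions of blocks of a flag
`τ`, the coefficients of the chains containing `τ` sum to zero. -/
lemma sum_coeff_of_superset {κ : Type*} (τ : Finset (Finset ι)) (hτ : IsFlag τ) (K : Finset κ)
    (a : κ → ℂ) (s : κ → Finset (Finset ι))
    (hs : ∀ k ∈ K, IsChain (· ⊆ ·) (s k : Set (Finset ι)))
    (hsat : ∀ k ∈ K, ∀ A ∈ s k, ∀ i j, (∀ B ∈ τ, i ∈ B ↔ j ∈ B) → (i ∈ A ↔ j ∈ A))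
    (h : ∀ x, ∑ k ∈ K, a k * cutFun (s k) x = 0) :
    ∑ k ∈ K with τ ⊆ s k, a k = 0 := by
  induction hm : τ.card generalizing τ K s with
  | zero =>
    rw [Finset.card_eq_zero] at hm
    -- Every cut-out function equals 1 at the origin.
    simpa [hm, cutFun] using h 0
  | succ m ih =>
    have hne : τ.Nonempty := Finset.card_pos.1 (by omega)
    obtain ⟨A₁, hA₁, hmin⟩ := Finset.exists_min_image τ Finset.card hne
    have hle : ∀ B ∈ τ, A₁ ⊆ B := by
      intro B hB
      rcases hτ.1.total hA₁ hB with h | h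
      · exact h
      · rw [Finset.eq_of_subset_of_card_le h (hmin B hB)]
    -- the next member of the flag, or the whole set
    obtain ⟨A₂, hA₂, hA₁₂, hA₂le⟩ : ∃ A₂, (A₂ ∈ τ.erase A₁ ∨ A₂ = Finset.univ) ∧ A₁ ⊂ A₂ ∧
        ∀ B ∈ τ.erase A₁, A₂ ⊆ B := by
      rcases (τ.erase A₁).eq_empty_or_nonempty with he | hne'
      · exact ⟨Finset.univ, Or.inr rfl, Finset.ssubset_univ_iff.2 (hτ.2 A₁ hA₁).2, by simp [he]⟩
      · obtain ⟨A₂, hA₂, hmin₂⟩ := Finset.exists_min_image _ Finset.card hne'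
        have hA₂τ := Finset.mem_of_mem_erase hA₂
        refine ⟨A₂, Or.inl hA₂, (hle A₂ hA₂τ).ssubset_of_ne (Finset.ne_of_mem_erase hA₂).symm,
          fun B hB => ?_⟩
        rcases hτ.1.total hA₂τ (Finset.mem_of_mem_erase hB) with h | h
        · exact h
        · rw [Finset.eq_of_subset_of_card_le h (hmin₂ B hB)]
    -- Choose `i` in the first block of `τ` and `j` in the second. Among members of `τ` only `A₁`
    -- separates them, so passing to `unseparated` removes `A₁` and merges these two blocks.
    obtain ⟨i, hi⟩ := (hτ.2 A₁ hA₁).1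
    obtain ⟨-, j, hj₂, hj₁⟩ := Finset.ssubset_iff_exists_subset_erase.1 hA₁₂ |>.elim
      fun j hj => (⟨trivial, j, hj.1, fun h => by simpa using hj.2 h⟩ :
        True ∧ ∃ j, j ∈ A₂ ∧ j ∉ A₁)
    have hij : ∀ B ∈ τ.erase A₁, i ∈ B ∧ j ∈ B := fun B hB =>
      ⟨hA₂le B hB (hA₁₂.1 hi), hA₂le B hB hj₂⟩
    have hcase : ∀ p q, (∀ B ∈ τ.erase A₁, p ∈ B ↔ q ∈ B) → (p ∈ A₁ ↔ q ∈ A₁) →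
        ∀ B ∈ τ, p ∈ B ↔ q ∈ B := by
      intro p q h1 h2 B hB
      by_cases hBA : B = A₁
      · rw [hBA]; exact h2
      · exact h1 B (Finset.mem_erase.2 ⟨hBA, hB⟩)
    have key := ih (τ.erase A₁) (hτ.mono (Finset.erase_subset _ _))
      (K.filter fun k => ∃ A ∈ s k, i ∈ A ∧ j ∉ A) (fun k => unseparated (s k) i j)
      (fun k hk => (hs k (Finset.mem_filter.1 hk).1).mono (by
        simp only [unseparated]; exact_mod_cast Finset.filter_subset _ _))
      ?_ (cutFun_relation K a s hs h i j).2 (by rw [Finset.card_erase_of_mem hA₁, hm]; rfl)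
    · rw [Finset.filter_filter] at key
      rw [← key]
      refine Finset.sum_congr (Finset.filter_congr fun k hk => ?_) fun _ _ => rfl
      constructor
      · intro hsub
        refine ⟨⟨A₁, hsub hA₁, hi, hj₁⟩, fun B hB => Finset.mem_filter.2
          ⟨hsub (Finset.mem_of_mem_erase hB), by simp [hij B hB]⟩⟩
      -- A separating member `A` lies inside `A₂`; being a union of blocks of `τ`, containing `i`
      -- and missing `j`, it must be `A₁`.
      · rintro ⟨⟨A, hA, hiA, hjA⟩, hsub⟩
        have hAA₂ : A ⊆ A₂ := by
          rcases hA₂ with hA₂ | rfl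
          · rcases (hs k hk).total hA (Finset.mem_filter.1 (hsub hA₂)).1 with h | h
            · exact h
            · exact absurd (h hj₂) hjA
          · exact Finset.subset_univ _
        have hAA₁ : A = A₁ := by
          ext b
          constructor
          · intro hb
            by_contra hb₁
            refine hjA ((hsat k hk A hA b j (hcase b j (fun B hB => ?_) (by simp [hb₁, hj₁]))).1 hb)
            simp [hij B hB, hA₂le B hB (hAA₂ hb)]
          · intro hb
            refine (hsat k hk A hA b i (hcase b i (fun B hB => ?_) (by simp [hb, hi]))).2 hiA
            simp [hij B hB, hle B (Finset.mem_of_mem_erase hB) hb]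
        intro B hB
        by_cases hBA : B = A₁
        · rw [hBA, ← hAA₁]; exact hA
        · exact (Finset.mem_filter.1 (hsub (Finset.mem_erase.2 ⟨hBA, hB⟩))).1
    -- The remaining members are unions of blocks of the coarser flag: they contain both or neither
    -- of the two merged blocks.
    · intro k hk A hA p q hpq
      rw [Finset.mem_filter] at hk
      simp only [unseparated, Finset.mem_filter] at hA
      have hiff := hsat k hk.1 A hA.1
      have hcross : ∀ p q, (∀ B ∈ τ.erase A₁, p ∈ B ↔ q ∈ B) → p ∈ A₁ → q ∉ A₁ →
          (p ∈ A ↔ q ∈ A) := by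
        intro p q hpq hp hq
        have h1 := hiff p i (hcase p i (fun B hB => by
          simp [hij B hB, hle B (Finset.mem_of_mem_erase hB) hp]) (by simp [hp, hi]))
        have h2 := hiff q j (hcase q j (fun B hB => by
          simp [hij B hB, (hpq B hB).1 (hle B (Finset.mem_of_mem_erase hB) hp)]) (by simp [hq, hj₁]))
        rw [h1, h2, hA.2]
      by_cases hp : p ∈ A₁
      · by_cases hq : q ∈ A₁
        · exact hiff p q (hcase p q hpq (by simp [hp, hq]))
        · exact hcross p q hpq hp hq
      · by_cases hq : q ∈ A₁
        · exact (hcross q p (fun B hB => (hpq B hB).symm) hq hp).symm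
        · exact hiff p q (hcase p q hpq (by simp [hp, hq]))

/-- The cut-out functions of flags are linearly independent. -/
theorem coeff_eq_zero_of_cutFun_relation (K : Finset (Finset (Finset ι))) (hK : ∀ σ ∈ K, IsFlag σ)
    (a : Finset (Finset ι) → ℂ) (h : ∀ x, ∑ σ ∈ K, a σ * cutFun σ x = 0)
    {τ : Finset (Finset ι)} (hτ : τ ∈ K) : a τ = 0 := by
  have hs : ∀ σ ∈ K, IsChain (· ⊆ ·) (σ : Set (Finset ι)) := fun σ hσ => (hK σ hσ).1
  -- Keep only the flags whose members are unions of blocks of `τ`; among these, only `τ` itself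
  -- contains `τ`.
  have h1 := cutFun_relation_unseparated K a id hs h
    (Finset.univ.filter fun q : ι × ι => ∀ B ∈ τ, q.1 ∈ B ↔ q.2 ∈ B)
  have h2 := sum_coeff_of_superset τ (hK τ hτ) _ a id
    (fun σ hσ => hs σ (Finset.mem_filter.1 hσ).1) ?_ h1
  · rw [← h2, Finset.filter_filter]
    rw [Finset.sum_eq_single_of_mem τ]
    · simp [hτ]
    · intro σ hσ hne
      obtain ⟨hσK, hsat, hsub⟩ := Finset.mem_filter.1 hσ
      refine absurd (Finset.Subset.antisymm ?_ hsub) hne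
      rw [← lowerSets_flagRel (hK τ hτ)]
      refine (subset_lowerSets_iff (hK σ hσK)).2 fun p q hpq A hA hq => ?_
      by_cases hqp : flagRel τ q p
      · exact (hsat (p, q) (by simpa using fun B hB => ⟨hqp B hB, hpq B hB⟩) A hA).2 hq
      · simp only [flagRel, not_forall] at hqp
        obtain ⟨C, hC, hpC, hqC⟩ := hqp
        rcases (hs σ hσK).total (hsub hC) hA with h | h
        · exact h hpC
        · exact absurd (h hq) hqC
  · intro σ hσ A hA i j hij
    exact (Finset.mem_filter.1 hσ).2 (i, j) (by simpa using hij) A hA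

end Independence

/-! ### Inclusion-exclusion and signed counts of chains -/

section Euler

variable {ι : Type*}

/-- The chains of members of `Q`. -/
def chains (Q : Finset (Finset ι)) : Finset (Finset (Finset ι)) :=
  Q.powerset.filter fun σ => IsChain (· ⊆ ·) (σ : Set (Finset ι))

lemma mem_chains {Q σ : Finset (Finset ι)} :
    σ ∈ chains Q ↔ σ ⊆ Q ∧ IsChain (· ⊆ ·) (σ : Set (Finset ι)) := by
  rw [chains, Finset.mem_filter, Finset.mem_powerset]

lemma ite_forall_eq_prod (σ : Finset (Finset ι)) (P : Finset ι → Prop)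
    [DecidablePred P] [Decidable (∀ A ∈ σ, P A)] :
    (if ∀ A ∈ σ, P A then (1 : ℂ) else 0) = ∏ A ∈ σ, if P A then 1 else 0 := by
  simp only [Finset.prod_boole]
  congr

/-- The signed number of chains in a family `Q` closed under union with one of its members `M`
vanishes. -/
lemma sum_chain_eq_zero (Q : Finset (Finset ι)) (M : Finset ι) (hM : M ∈ Q)
    (hQ : ∀ A ∈ Q, A ⊔ M ∈ Q) :
    ∑ σ ∈ chains Q, (-1 : ℂ) ^ σ.card = 0 := by
  -- A sign-reversing involution on chains: insert or delete the union of `M` with the largest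
  -- member not containing `M`. This set contains `M`, so toggling it does not affect its own
  -- definition.
  set U : Finset (Finset ι) → Finset ι := fun σ => (σ.filter (¬ M ⊆ ·)).sup id ⊔ M with hU
  have hMU : ∀ σ, M ⊆ U σ := fun σ => le_sup_right (α := Finset ι)
  set T : Finset (Finset ι) → Finset (Finset ι) := fun σ =>
    if U σ ∈ σ then σ.erase (U σ) else insert (U σ) σ with hT
  have hUT : ∀ σ, U (T σ) = U σ := by
    intro σ
    have : (T σ).filter (¬ M ⊆ ·) = σ.filter (¬ M ⊆ ·) := by
      ext A
      simp only [hT, Finset.mem_filter]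
      refine and_congr_left fun hA => ?_
      have : A ≠ U σ := fun h => hA (h ▸ hMU σ)
      split_ifs <;> simp [this]
    simp only [hU] at this ⊢
    rw [this]
  have hTT : ∀ σ, T (T σ) = σ := by
    intro σ
    have h1 := hUT σ
    by_cases h : U σ ∈ σ
    · have h2 : T σ = σ.erase (U σ) := if_pos h
      have h3 : T (T σ) = if U (T σ) ∈ T σ then (T σ).erase (U (T σ)) else insert (U (T σ)) (T σ) :=
        rfl
      rw [h3, h1, h2, if_neg (by simp), Finset.insert_erase h]
    · have h2 : T σ = insert (U σ) σ := if_neg h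
      have h3 : T (T σ) = if U (T σ) ∈ T σ then (T σ).erase (U (T σ)) else insert (U (T σ)) (T σ) :=
        rfl
      rw [h3, h1, h2, if_pos (by simp), Finset.erase_insert h]
  refine Finset.sum_involution (fun σ _ => T σ) (fun σ _ => ?_) (fun σ _ _ => ?_) (fun σ hσ => ?_)
    (fun σ _ => hTT σ)
  · by_cases h : U σ ∈ σ
    · have h2 : T σ = σ.erase (U σ) := if_pos h
      rw [h2, ← Finset.card_erase_add_one h, pow_succ]
      ring
    · have h2 : T σ = insert (U σ) σ := if_neg h
      rw [h2, Finset.card_insert_of_notMem h, pow_succ]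
      ring
  · intro h'
    by_cases h : U σ ∈ σ
    · have h2 : T σ = σ.erase (U σ) := if_pos h
      exact Finset.notMem_erase (U σ) σ (by rw [← h2, h']; exact h)
    · have h2 : T σ = insert (U σ) σ := if_neg h
      rw [h2] at h'
      exact h (Finset.insert_eq_self.1 h')
  · rw [mem_chains] at hσ ⊢
    obtain ⟨hσQ, hσc⟩ := hσ
    by_cases h : U σ ∈ σ
    · have h2 : T σ = σ.erase (U σ) := if_pos h
      rw [h2]
      exact ⟨(Finset.erase_subset _ _).trans hσQ,
        hσc.mono (by exact_mod_cast Finset.erase_subset _ _)⟩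
    · have h2 : T σ = insert (U σ) σ := if_neg h
      rw [h2]
      refine ⟨Finset.insert_subset ?_ hσQ, ?_⟩
      · rcases (σ.filter (¬ M ⊆ ·)).eq_empty_or_nonempty with he | hne
        · simpa [hU, he] using hM
        · -- the supremum of a nonempty finite chain is attained
          obtain ⟨A, hA, hmax⟩ := Finset.exists_max_image _ Finset.card hne
          have hsup : (σ.filter (¬ M ⊆ ·)).sup id = A := by
            refine le_antisymm (Finset.sup_le fun B hB => ?_) (Finset.le_sup (f := id) hA)
            rcases hσc.total (Finset.mem_filter.1 hA).1 (Finset.mem_filter.1 hB).1 with h | h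
            · exact (Finset.eq_of_subset_of_card_le h (hmax B hB)).ge
            · exact h
          simp only [hU, hsup]
          exact hQ A (hσQ (Finset.mem_filter.1 hA).1)
      · rw [Finset.coe_insert]
        refine hσc.insert fun C hC _ => ?_
        by_cases hMC : M ⊆ C
        · refine Or.inl (sup_le (Finset.sup_le fun A hA => ?_) hMC)
          obtain ⟨hA, hMA⟩ := Finset.mem_filter.1 hA
          rcases hσc.total hA hC with h | h
          · exact h
          · exact absurd (hMC.trans h) hMA
        · refine Or.inr (le_trans ?_ (le_sup_left (α := Finset ι)))
          exact Finset.le_sup (f := id) (Finset.mem_filter.2 ⟨hC, hMC⟩)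

variable [Fintype ι]

/-- Expand the product over `A ∈ σ` using that the indicator of `0 ≤ s` is 1 minus the indicator of
`s < 0`; the inverse formula is `openFun_eq_sum_cutFun`. -/
lemma cutFun_eq_sum_openFun (σ : Finset (Finset ι)) (x : ι → ℝ) :
    cutFun σ x = ∑ τ ∈ σ.powerset, openFun τ x := by
  simp only [cutFun, openFun]
  by_cases hx : ∑ i, x i = 0
  · simp only [hx, true_and, if_true]
    have := Finset.prod_add (fun A => if 0 ≤ ∑ i ∈ A, x i then (0 : ℂ) else -1)
      (fun _ => (1 : ℂ)) σ
    simp only [Finset.prod_const_one, mul_one] at this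
    rw [← this, ite_forall_eq_prod]
    refine Finset.prod_congr rfl fun A _ => ?_
    split_ifs <;> simp
  · simp [hx]

lemma openFun_eq_sum_cutFun (σ : Finset (Finset ι)) (x : ι → ℝ) :
    openFun σ x = ∑ τ ∈ σ.powerset, (-1) ^ (σ \ τ).card * cutFun τ x := by
  simp only [cutFun, openFun]
  by_cases hx : ∑ i, x i = 0
  · simp only [hx, true_and, if_true]
    have := Finset.prod_add (fun A => if 0 ≤ ∑ i ∈ A, x i then (1 : ℂ) else 0)
      (fun _ => (-1 : ℂ)) σ
    simp only [Finset.prod_const] at this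
    simp only [mul_comm ((-1 : ℂ) ^ _), ite_forall_eq_prod]
    rw [← this]
    refine Finset.prod_congr rfl fun A _ => ?_
    split_ifs <;> simp
  · simp [hx]

/-- The cone cut out by the lower sets of a relation is a signed combination of open dual cones of
chains of lower sets. -/
theorem cutFun_lowerSets (r : ι → ι → Prop) (x : ι → ℝ) :
    cutFun (lowerSets r) x =
      ∑ σ ∈ chains (lowerSets r), openFun σ x := by
  by_cases hx : ∑ i, x i = 0
  swap
  · simp [cutFun, openFun, hx]
  -- At a fixed `x`, only chains of lower sets with negative sum contribute, each with the sign of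
  -- its length. The total is 1 if there is no such set, and must be shown to vanish otherwise.
  set Q := (lowerSets r).filter fun A => ¬ 0 ≤ ∑ i ∈ A, x i with hQ
  have hsum : ∑ σ ∈ chains (lowerSets r), openFun σ x =
      ∑ σ ∈ chains Q, (-1 : ℂ) ^ σ.card := by
    symm
    refine Finset.sum_subset_zero_on_sdiff
      (Finset.filter_subset_filter _ (Finset.powerset_mono.2 (Finset.filter_subset _ (lowerSets r)))) ?_ ?_
    · intro σ hσ
      simp only [Finset.mem_sdiff, mem_chains, not_and] at hσ
      have : ¬ σ ⊆ Q := fun h => hσ.2 h hσ.1.2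
      obtain ⟨A, hA, hAQ⟩ := Finset.not_subset.1 this
      rw [openFun, if_pos hx, Finset.prod_eq_zero hA]
      rw [if_pos]
      by_contra hneg
      exact hAQ (Finset.mem_filter.2 ⟨hσ.1.1 hA, hneg⟩)
    · intro σ hσ
      rw [mem_chains] at hσ
      rw [openFun, if_pos hx, Finset.prod_congr rfl (g := fun _ => (-1 : ℂ)), Finset.prod_const]
      intro A hA
      rw [if_neg (Finset.mem_filter.1 (hσ.1 hA)).2]
  rw [hsum]
  rcases Q.eq_empty_or_nonempty with he | hne
  · have : ∀ A ∈ lowerSets r, 0 ≤ ∑ i ∈ A, x i := by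
      intro A hA
      by_contra hneg
      have : A ∈ Q := Finset.mem_filter.2 ⟨hA, hneg⟩
      simp [he] at this
    rw [cutFun, if_pos ⟨hx, this⟩, he, chains, Finset.powerset_empty, Finset.filter_singleton,
      if_pos (by simp)]
    simp
  -- With `M` of least sum, modularity of `A ↦ ∑ i ∈ A, x i` makes the sum over `A ⊔ M` negative:
  -- the sum over `A ⊓ M` is either nonnegative or at least that over `M`. The union is proper
  -- because the full sum is zero.
  · obtain ⟨M, hM, hmin⟩ := Finset.exists_min_image Q (fun A => ∑ i ∈ A, x i) hne
    rw [sum_chain_eq_zero Q M hM, cutFun, if_neg]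
    · rintro ⟨-, h⟩
      obtain ⟨hML, hMneg⟩ := Finset.mem_filter.1 hM
      exact hMneg (h M hML)
    · intro A hA
      have hmod : ∑ i ∈ A ⊔ M, x i + ∑ i ∈ A ⊓ M, x i = ∑ i ∈ A, x i + ∑ i ∈ M, x i :=
        Finset.sum_union_inter
      obtain ⟨hAL, hAneg⟩ := Finset.mem_filter.1 hA
      obtain ⟨hML, hMneg⟩ := Finset.mem_filter.1 hM
      obtain ⟨hAne, hAu, hAl⟩ := mem_lowerSets.1 hAL
      obtain ⟨hMne, hMu, hMl⟩ := mem_lowerSets.1 hML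
      have hneg : ¬ 0 ≤ ∑ i ∈ A ⊔ M, x i := by
        push Not at hAneg hMneg ⊢
        by_cases hI : A ⊓ M ∈ Q
        · have := hmin _ hI
          linarith
        · have : 0 ≤ ∑ i ∈ A ⊓ M, x i := by
            by_contra hcon
            rcases (A ⊓ M).eq_empty_or_nonempty with h0 | h0
            · simp [h0] at hcon
            · refine hI (Finset.mem_filter.2 ⟨mem_lowerSets.2 ⟨h0, fun hu => hAu ?_, ?_⟩, hcon⟩)
              · exact Finset.univ_subset_iff.1 (hu ▸ inf_le_left (α := Finset ι))
              · intro a b hab hb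
                rw [Finset.inf_eq_inter, Finset.mem_inter] at hb ⊢
                exact ⟨hAl a b hab hb.1, hMl a b hab hb.2⟩
          linarith
      refine Finset.mem_filter.2 ⟨mem_lowerSets.2 ⟨?_, fun hu => ?_, ?_⟩, hneg⟩
      · exact hAne.mono (le_sup_left (α := Finset ι))
      · rw [hu, hx] at hneg
        exact hneg le_rfl
      · intro a b hab hb
        rw [Finset.sup_eq_union, Finset.mem_union] at hb ⊢
        exact hb.imp (hAl a b hab) (hMl a b hab)

end Euler

/-! ### Two bases of the span of flags, and coordinates of cones -/

section FlagSpace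

/-- Linear independence by triangularity with respect to a family of functionals. -/
lemma linearIndependent_of_triangular {C V α : Type*} [Finite C] [AddCommGroup V] [Module ℂ V]
    [LinearOrder α] (v : C → V) (φ : C → V →ₗ[ℂ] ℂ) (key : C → α) (h₁ : ∀ c, φ c (v c) ≠ 0)
    (h₂ : ∀ c c', φ c (v c') ≠ 0 → c' = c ∨ key c < key c') : LinearIndependent ℂ v := by
  cases nonempty_fintype C
  rw [Fintype.linearIndependent_iff]
  intro g hg
  by_contra! hne
  -- At a nonzero coefficient of largest key, the functional `φ c` sees no other vector with nonzero
  -- coefficient.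
  obtain ⟨c, hc, hmax⟩ := Finset.exists_max_image (Finset.univ.filter fun c => g c ≠ 0) key
    (by simpa [Finset.Nonempty] using hne)
  rw [Finset.mem_filter] at hc
  have h := congrArg (φ c) hg
  rw [map_sum, map_zero, Finset.sum_eq_single c] at h
  · rw [map_smul, smul_eq_mul, mul_eq_zero] at h
    exact h.elim hc.2 (h₁ c)
  · intro c' _ hne'
    by_contra hcon
    rw [map_smul, smul_eq_mul, mul_eq_zero, not_or] at hcon
    rcases h₂ c c' hcon.2 with h | h
    · exact hne' h
    · exact absurd (hmax c' (Finset.mem_filter.2 ⟨Finset.mem_univ _, hcon.1⟩)) (not_le.2 h)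
  · simp

variable (ι : Type*) [Fintype ι]

/-- The type of flags. -/
abbrev Flag : Type _ := {σ : Finset (Finset ι) // IsFlag σ}

/-- The span of the cut-out functions of flags. -/
def flagSpace : Submodule ℂ ((ι → ℝ) → ℂ) :=
  Submodule.span ℂ (Set.range fun σ : Flag ι => cutFun σ.1)

lemma linearIndependent_cutFun : LinearIndependent ℂ fun σ : Flag ι => cutFun σ.1 := by
  rw [Fintype.linearIndependent_iff]
  intro g hg σ
  have := coeff_eq_zero_of_cutFun_relation (Finset.univ.filter IsFlag)
    (fun τ hτ => (Finset.mem_filter.1 hτ).2) (fun τ => if h : IsFlag τ then g ⟨τ, h⟩ else 0)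
    (fun x => ?_) (τ := σ.1) (by simpa using σ.2)
  · simpa [σ.2] using this
  · rw [← Finset.sum_subtype_of_mem _ (p := IsFlag) (fun τ hτ => (Finset.mem_filter.1 hτ).2)]
    have h2 := congrFun hg x
    simp only [Finset.sum_apply, Pi.smul_apply, smul_eq_mul, Pi.zero_apply] at h2
    rw [← h2]
    refine Finset.sum_congr (by ext; simp [Subtype.prop]) fun τ _ => ?_
    simp [τ.2]

lemma finrank_flagSpace : Module.finrank ℂ (flagSpace ι) = Fintype.card (Flag ι) :=
  finrank_span_eq_card (linearIndependent_cutFun ι)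

instance : FiniteDimensional ℂ (flagSpace ι) :=
  FiniteDimensional.span_of_finite ℂ (Set.finite_range _)

variable {ι} in
lemma openFun_mem_of_cutFun_mem {S : Submodule ℂ ((ι → ℝ) → ℂ)} {σ : Finset (Finset ι)}
    (h : ∀ τ ⊆ σ, cutFun τ ∈ S) : openFun σ ∈ S := by
  have : openFun σ = ∑ τ ∈ σ.powerset, ((-1 : ℂ) ^ (σ \ τ).card) • cutFun τ := by
    funext x
    simp [openFun_eq_sum_cutFun, Finset.sum_apply]
  rw [this]
  exact Submodule.sum_mem _ fun τ hτ => Submodule.smul_mem _ _ (h τ (Finset.mem_powerset.1 hτ))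

lemma span_openFun : Submodule.span ℂ (Set.range fun σ : Flag ι => openFun σ.1) = flagSpace ι := by
  apply le_antisymm
  · rw [Submodule.span_le]
    rintro _ ⟨σ, rfl⟩
    exact openFun_mem_of_cutFun_mem fun τ hτ => Submodule.subset_span ⟨⟨τ, σ.2.mono hτ⟩, rfl⟩
  · rw [flagSpace, Submodule.span_le]
    rintro _ ⟨σ, rfl⟩
    have : cutFun σ.1 = ∑ τ ∈ σ.1.powerset, openFun τ := by
      funext x
      simp [cutFun_eq_sum_openFun, Finset.sum_apply]
    simp only [this]
    refine Submodule.sum_mem _ fun τ hτ => Submodule.subset_span ?_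
    exact ⟨⟨τ, σ.2.mono (Finset.mem_powerset.1 hτ)⟩, rfl⟩

/-- A spanning family with as many members as the dimension is independent. -/
lemma linearIndependent_openFun : LinearIndependent ℂ fun σ : Flag ι => openFun σ.1 := by
  rw [linearIndependent_iff_card_le_finrank_span, Set.finrank, span_openFun, finrank_flagSpace]

/-- The basis of the space of flags formed by the functions `openFun`. -/
def openBasis : Module.Basis (Flag ι) ℂ (flagSpace ι) :=
  (Module.Basis.span (linearIndependent_openFun ι)).map (LinearEquiv.ofEq _ _ (span_openFun ι))

lemma coe_openBasis (σ : Flag ι) : (openBasis ι σ : (ι → ℝ) → ℂ) = openFun σ.1 := by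
  simp [openBasis, Module.Basis.span_apply]

variable {ι}

lemma isFlag_of_mem_chains {r : ι → ι → Prop} {σ : Finset (Finset ι)}
    (h : σ ∈ chains (lowerSets r)) : IsFlag σ :=
  ⟨(mem_chains.1 h).2, fun _ hA =>
    ⟨(mem_lowerSets.1 ((mem_chains.1 h).1 hA)).1, (mem_lowerSets.1 ((mem_chains.1 h).1 hA)).2.1⟩⟩

/-- Chains of lower sets of `r` are exactly the flags whose preorder contains `r`, so
`cutFun_lowerSets` becomes an expansion with coefficients 0 and 1. -/
lemma cutFun_lowerSets_eq_sum (r : ι → ι → Prop) : cutFun (lowerSets r) =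
    ∑ σ : Flag ι, (if ∀ a b, r a b → flagRel σ.1 a b then (1 : ℂ) else 0) •
      (openBasis ι σ : (ι → ℝ) → ℂ) := by
  funext x
  rw [cutFun_lowerSets, Finset.sum_apply]
  simp only [coe_openBasis, Pi.smul_apply, smul_eq_mul, ite_mul, one_mul, zero_mul]
  rw [← Finset.sum_filter]
  symm
  refine Finset.sum_bij (fun σ _ => σ.1) (fun σ hσ => ?_) (fun _ _ _ _ h => Subtype.ext h)
    (fun σ hσ => ?_) (fun _ _ => rfl)
  · exact mem_chains.2 ⟨(subset_lowerSets_iff σ.2).2 (Finset.mem_filter.1 hσ).2, σ.2.1⟩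
  · refine ⟨⟨σ, isFlag_of_mem_chains hσ⟩, Finset.mem_filter.2 ⟨Finset.mem_univ _, ?_⟩, rfl⟩
    exact (subset_lowerSets_iff (isFlag_of_mem_chains hσ)).1 (mem_chains.1 hσ).1

lemma cutFun_lowerSets_mem (r : ι → ι → Prop) : cutFun (lowerSets r) ∈ flagSpace ι := by
  rw [cutFun_lowerSets_eq_sum]
  exact Submodule.sum_mem _ fun σ _ => Submodule.smul_mem _ _ (openBasis ι σ).2

lemma openBasis_coord (r : ι → ι → Prop) (σ : Flag ι) (f : flagSpace ι)
    [Decidable (∀ a b, r a b → flagRel σ.1 a b)]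
    (hf : (f : (ι → ℝ) → ℂ) = cutFun (lowerSets r)) :
    (openBasis ι).coord σ f = if ∀ a b, r a b → flagRel σ.1 a b then 1 else 0 := by
  have : f = ∑ σ : Flag ι, (if ∀ a b, r a b → flagRel σ.1 a b then (1 : ℂ) else 0) •
      openBasis ι σ := by
    apply Subtype.ext
    rw [hf, cutFun_lowerSets_eq_sum]
    simp only [Submodule.coe_sum, Submodule.coe_smul]
  rw [this, Module.Basis.coord_apply, Module.Basis.repr_sum_self]
  congr

end FlagSpace

/-! ### Standard relations, weak orders and prefix minima -/

section PrefixMin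

variable {n : ℕ} {r q q' : Fin n → Fin n → Prop}

/-- The least element weakly preceding `a`. -/
def prefixMin (r : Fin n → Fin n → Prop) (a : Fin n) : Fin n :=
  (Finset.univ.filter fun b => b = a ∨ r b a).min' ⟨a, by simp⟩

lemma prefixMin_le_self (r : Fin n → Fin n → Prop) (a : Fin n) : prefixMin r a ≤ a :=
  Finset.min'_le _ _ (by simp)

lemma prefixMin_le {a b : Fin n} (h : r b a) : prefixMin r a ≤ b :=
  Finset.min'_le _ _ (by simp [h])

lemma prefixMin_rel (hr : ∀ a, r a a) (a : Fin n) : r (prefixMin r a) a := by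
  have := Finset.min'_mem (Finset.univ.filter fun b => b = a ∨ r b a) ⟨a, by simp⟩
  rw [Finset.mem_filter] at this
  rcases this.2 with h | h
  · rw [prefixMin, h]; exact hr a
  · exact h

lemma le_prefixMin (hr : ∀ a, r a a) {a c : Fin n} (h : ∀ b, r b a → c ≤ b) : c ≤ prefixMin r a :=
  h _ (prefixMin_rel hr a)

/-- A total preorder. -/
structure IsWeakOrder (r : Fin n → Fin n → Prop) : Prop where
  total : ∀ a b, r a b ∨ r b a
  trans : ∀ a b c, r a b → r b c → r a c

lemma IsWeakOrder.refl (h : IsWeakOrder r) (a : Fin n) : r a a := by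
  simpa using h.total a a

/-- A preorder whose comparability classes are the fibres of the prefix minimum: a disjoint union
of total preorders, each with its least label at the bottom. -/
structure IsStandardRel (r : Fin n → Fin n → Prop) : Prop where
  refl : ∀ a, r a a
  trans : ∀ a b c, r a b → r b c → r a c
  eq_iff : ∀ a b, prefixMin r a = prefixMin r b ↔ r a b ∨ r b a

/-- Concatenate the components of a standard relation by decreasing least labels. -/
def concat (q : Fin n → Fin n → Prop) (a b : Fin n) : Prop := prefixMin q b < prefixMin q a ∨ q a b

/-- Cut a total preorder where the prefix minimum changes. -/
def cut (r : Fin n → Fin n → Prop) (a b : Fin n) : Prop := prefixMin r a = prefixMin r b ∧ r a b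

lemma IsWeakOrder.prefixMin_anti (h : IsWeakOrder r) {a b : Fin n} (hab : r a b) :
    prefixMin r b ≤ prefixMin r a :=
  prefixMin_le (h.trans _ _ _ (prefixMin_rel h.refl a) hab)

lemma IsWeakOrder.prefixMin_prefixMin (h : IsWeakOrder r) (a : Fin n) :
    prefixMin r (prefixMin r a) = prefixMin r a :=
  le_antisymm (prefixMin_le_self r _) (h.prefixMin_anti (prefixMin_rel h.refl a))

/-- The element attaining the prefix minimum of `a` has the same prefix minimum, so it stays in the
component of `a` after cutting. -/
lemma IsWeakOrder.prefixMin_cut (h : IsWeakOrder r) : prefixMin (cut r) = prefixMin r := by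
  funext a
  refine le_antisymm (prefixMin_le ⟨h.prefixMin_prefixMin a, prefixMin_rel h.refl a⟩) ?_
  exact le_prefixMin (fun a => ⟨rfl, h.refl a⟩) fun b hb => prefixMin_le hb.2

lemma IsWeakOrder.isStandardRel_cut (h : IsWeakOrder r) : IsStandardRel (cut r) where
  refl a := ⟨rfl, h.refl a⟩
  trans a b c h₁ h₂ := ⟨h₁.1.trans h₂.1, h.trans _ _ _ h₁.2 h₂.2⟩
  eq_iff a b := by
    rw [h.prefixMin_cut]
    constructor
    · intro hab
      exact (h.total a b).imp (fun h => ⟨hab, h⟩) fun h => ⟨hab.symm, h⟩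
    · rintro (h | h)
      · exact h.1
      · exact h.1.symm

lemma IsStandardRel.prefixMin_eq (h : IsStandardRel q) {a b : Fin n} (hab : q a b) :
    prefixMin q a = prefixMin q b := (h.eq_iff a b).2 (Or.inl hab)

lemma IsStandardRel.isWeakOrder_concat (h : IsStandardRel q) :
    IsWeakOrder (concat q) where
  total a b := by
    rcases lt_trichotomy (prefixMin q a) (prefixMin q b) with hlt | heq | hgt
    · exact Or.inr (Or.inl hlt)
    · exact ((h.eq_iff a b).1 heq).imp Or.inr Or.inr
    · exact Or.inl (Or.inl hgt)
  trans a b c := by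
    rintro (h₁ | h₁) (h₂ | h₂)
    · exact Or.inl (h₂.trans h₁)
    · exact Or.inl ((h.prefixMin_eq h₂) ▸ h₁)
    · exact Or.inl ((h.prefixMin_eq h₁) ▸ h₂)
    · exact Or.inr (h.trans _ _ _ h₁ h₂)

/-- Components placed earlier have larger least labels and cannot lower the minimum. -/
lemma IsStandardRel.prefixMin_concat (h : IsStandardRel q) :
    prefixMin (concat q) = prefixMin q := by
  funext a
  refine le_antisymm (prefixMin_le (Or.inr (prefixMin_rel h.refl a))) ?_
  refine le_prefixMin (fun a => Or.inr (h.refl a)) fun b hb => ?_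
  rcases hb with hb | hb
  · exact hb.le.trans (prefixMin_le_self q b)
  · exact prefixMin_le hb

lemma IsWeakOrder.concat_cut (h : IsWeakOrder r) : concat (cut r) = r := by
  funext a b
  simp only [concat, cut, h.prefixMin_cut, eq_iff_iff]
  constructor
  · rintro (hab | hab)
    · exact (h.total a b).resolve_right fun hba => absurd (h.prefixMin_anti hba) (not_le.2 hab)
    · exact hab.2
  · intro hab
    exact (h.prefixMin_anti hab).lt_or_eq.imp id fun he => ⟨he.symm, hab⟩

lemma IsStandardRel.cut_concat (h : IsStandardRel q) : cut (concat q) = q := by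
  funext a b
  simp only [cut, h.prefixMin_concat, eq_iff_iff]
  constructor
  · rintro ⟨he, hab | hab⟩
    · exact absurd he hab.ne'
    · exact hab
  · intro hab
    exact ⟨h.prefixMin_eq hab, Or.inr hab⟩

/-- Concatenation is strict between components, so ties occur only inside one. -/
lemma IsStandardRel.concat_antisymm_iff (h : IsStandardRel q) :
    (∀ a b, concat q a b → concat q b a → a = b) ↔ ∀ a b, q a b → q b a → a = b := by
  constructor
  · intro hc a b hab hba
    exact hc a b (Or.inr hab) (Or.inr hba)
  · rintro hc a b (hab | hab) (hba | hba)
    · exact absurd hab hba.asymm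
    · exact absurd (h.prefixMin_eq hba) hab.ne
    · exact absurd (h.prefixMin_eq hab) hba.ne
    · exact hc a b hab hba

/-- A key with respect to which standard relations are triangular. -/
def relKey (q : Fin n → Fin n → Prop) : ℕ ×ₗ ℕᵒᵈ :=
  toLex (∑ a, (prefixMin q a : ℕ),
    OrderDual.toDual (Finset.univ.filter fun p : Fin n × Fin n => q p.1 p.2).card)

lemma IsStandardRel.eq_or_relKey_lt (h : IsStandardRel q) (h' : IsStandardRel q')
    (hsub : ∀ a b, q' a b → concat q a b) : q' = q ∨ relKey q < relKey q' := by
  have hle : ∀ a, prefixMin q a ≤ prefixMin q' a := by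
    intro a
    rw [← h.prefixMin_concat]
    exact prefixMin_le (hsub _ _ (prefixMin_rel h'.refl a))
  rw [or_iff_not_imp_left]
  intro hne
  rw [relKey, relKey, Prod.Lex.toLex_lt_toLex]
  -- If all prefix minima agree, `q'` cannot relate different components of `q`, hence is contained
  -- in `q`, and the dual cardinality decides; otherwise the sum of prefix minima increases.
  by_cases heq : ∀ a, prefixMin q a = prefixMin q' a
  · right
    refine ⟨by simp only [heq], OrderDual.toDual_lt_toDual.2 ?_⟩
    have hqq : ∀ a b, q' a b → q a b := by
      intro a b hab
      rcases hsub a b hab with hlt | hq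
      · have := h'.prefixMin_eq hab
        rw [← heq, ← heq] at this
        exact absurd this hlt.ne'
      · exact hq
    apply Finset.card_lt_card
    refine Finset.ssubset_iff_subset_ne.2 ⟨Finset.monotone_filter_right _ fun p _ => hqq _ _,
      fun he => hne ?_⟩
    funext a b
    have := congrArg ((a, b) ∈ ·) he
    simpa using this
  · left
    push Not at heq
    obtain ⟨a, ha⟩ := heq
    exact Finset.sum_lt_sum (f := fun a => (prefixMin q a : ℕ)) (g := fun a => (prefixMin q' a : ℕ))
      (fun a _ => hle a) ⟨a, Finset.mem_univ _, (hle a).lt_of_ne ha⟩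

end PrefixMin

/-! ### Ordered set partitions as total preorders -/

namespace OrderedSetPartition

variable {n : ℕ} {J : Finset (Fin n)}

/-- The union of the first `j` blocks. -/
def initial (π : OrderedSetPartition J) (j : ℕ) : Finset (Fin n) :=
  (π.blocks.take j).toFinset.biUnion id

/-- The total preorder on `J` given by the position of the blocks. -/
def rel (π : OrderedSetPartition J) (a b : Fin n) : Prop :=
  a ∈ J ∧ b ∈ J ∧ ∀ j, b ∈ π.initial j → a ∈ π.initial j

variable (π : OrderedSetPartition J)

lemma mem_initial {j : ℕ} {a : Fin n} :
    a ∈ π.initial j ↔ ∃ i, ∃ h : i < π.blocks.length, i < j ∧ a ∈ π.blocks[i] := by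
  simp only [initial, Finset.mem_biUnion, List.mem_toFinset, id, List.mem_take_iff_getElem]
  constructor
  · rintro ⟨S, ⟨i, hi, rfl⟩, ha⟩
    exact ⟨i, by omega, by omega, ha⟩
  · rintro ⟨i, h, hij, ha⟩
    exact ⟨_, ⟨i, by omega, rfl⟩, ha⟩

lemma initial_mono : Monotone π.initial := by
  intro j k hjk a ha
  rw [mem_initial] at ha ⊢
  obtain ⟨i, h, hij, ha⟩ := ha
  exact ⟨i, h, by omega, ha⟩

lemma initial_subset (j : ℕ) : π.initial j ⊆ J := by
  intro a ha
  obtain ⟨i, h, -, ha⟩ := π.mem_initial.1 ha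
  exact (π.mem_iff a).2 ⟨_, List.getElem_mem h, ha⟩

lemma initial_zero : π.initial 0 = ∅ := by
  ext a
  simp [mem_initial]

lemma initial_of_length_le {j : ℕ} (hj : π.blocks.length ≤ j) : π.initial j = J := by
  refine (π.initial_subset j).antisymm fun a ha => ?_
  obtain ⟨S, hS, haS⟩ := (π.mem_iff a).1 ha
  obtain ⟨i, hi, rfl⟩ := List.getElem_of_mem hS
  exact π.mem_initial.2 ⟨i, hi, by omega, haS⟩

lemma eq_of_mem_getElem {i j : ℕ} {hi : i < π.blocks.length} {hj : j < π.blocks.length} {a : Fin n}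
    (h : a ∈ π.blocks[i]) (h' : a ∈ π.blocks[j]) : i = j := by
  have := List.pairwise_iff_getElem.1 π.pairwise_disjoint
  rcases lt_trichotomy i j with hlt | heq | hgt
  · exact absurd h' (Finset.disjoint_left.1 (this i j hi hj hlt) h)
  · exact heq
  · exact absurd h (Finset.disjoint_left.1 (this j i hj hi hgt) h')

lemma mem_initial_iff_lt {i : ℕ} {hi : i < π.blocks.length} {a : Fin n} (h : a ∈ π.blocks[i])
    (j : ℕ) : a ∈ π.initial j ↔ i < j := by
  rw [mem_initial]
  constructor
  · rintro ⟨k, hk, hkj, ha⟩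
    rwa [π.eq_of_mem_getElem h ha]
  · intro hij
    exact ⟨i, hi, hij, h⟩

lemma exists_mem_getElem {a : Fin n} (ha : a ∈ J) :
    ∃ i, ∃ h : i < π.blocks.length, a ∈ π.blocks[i] := by
  obtain ⟨S, hS, haS⟩ := (π.mem_iff a).1 ha
  obtain ⟨i, hi, rfl⟩ := List.getElem_of_mem hS
  exact ⟨i, hi, haS⟩

lemma rel_iff_le {i j : ℕ} {hi : i < π.blocks.length} {hj : j < π.blocks.length} {a b : Fin n}
    (ha : a ∈ π.blocks[i]) (hb : b ∈ π.blocks[j]) : π.rel a b ↔ i ≤ j := by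
  have haJ : a ∈ J := (π.mem_iff a).2 ⟨_, List.getElem_mem hi, ha⟩
  have hbJ : b ∈ J := (π.mem_iff b).2 ⟨_, List.getElem_mem hj, hb⟩
  simp only [rel, haJ, hbJ, true_and, π.mem_initial_iff_lt ha, π.mem_initial_iff_lt hb]
  exact ⟨fun h => Nat.lt_succ_iff.1 (h (j + 1) (Nat.lt_succ_self j)), fun h k hk => by omega⟩

lemma rel_total {a b : Fin n} (ha : a ∈ J) (hb : b ∈ J) : π.rel a b ∨ π.rel b a := by
  obtain ⟨i, hi, hai⟩ := π.exists_mem_getElem ha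
  obtain ⟨j, hj, hbj⟩ := π.exists_mem_getElem hb
  rw [π.rel_iff_le hai hbj, π.rel_iff_le hbj hai]
  exact le_total i j

lemma rel_trans {a b c : Fin n} (hab : π.rel a b) (hbc : π.rel b c) : π.rel a c :=
  ⟨hab.1, hbc.2.1, fun j hj => hab.2.2 j (hbc.2.2 j hj)⟩

lemma initial_lower {a b : Fin n} (hab : π.rel a b) {j : ℕ} (hb : b ∈ π.initial j) :
    a ∈ π.initial j := hab.2.2 j hb

lemma eq_initial_of_lower {A : Finset (Fin n)} (hA : A ⊆ J)
    (hl : ∀ a b, π.rel a b → b ∈ A → a ∈ A) : ∃ j ≤ π.blocks.length, A = π.initial j := by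
  have hex : ∃ j, A ⊆ π.initial j := ⟨_, hA.trans (π.initial_of_length_le le_rfl).ge⟩
  refine ⟨Nat.find hex, Nat.find_min' hex (hA.trans (π.initial_of_length_le le_rfl).ge),
    (Nat.find_spec hex).antisymm ?_⟩
  rcases hj : Nat.find hex with _ | j
  · simp [initial_zero]
  · have hnot : ¬ A ⊆ π.initial j := Nat.find_min hex (by omega)
    obtain ⟨a, haA, haj⟩ := Finset.not_subset.1 hnot
    intro d hd
    refine hl d a ⟨π.initial_subset _ hd, hA haA, fun i hi => ?_⟩ haA
    refine π.initial_mono (?_ : j + 1 ≤ i) hd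
    by_contra hlt
    exact haj (π.initial_mono (by omega) hi)

/-- The lower sets inside `J` are the unions of initial blocks; the empty union and `J` itself give
only the trivial inequality. -/
lemma mem_plate_iff (x : Fin n → ℝ) : x ∈ π.plate ↔
    (∀ i, i ∉ J → x i = 0) ∧ ∑ i ∈ J, x i = 0 ∧
      ∀ A ⊆ J, (∀ a b, π.rel a b → b ∈ A → a ∈ A) → 0 ≤ ∑ i ∈ A, x i := by
  simp only [plate, Set.mem_ofPred_eq]
  refine and_congr_right fun h0 => ?_
  have hsum : ∑ i, x i = ∑ i ∈ J, x i :=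
    (Finset.sum_subset (Finset.subset_univ J) fun i _ hi => h0 i hi).symm
  rw [hsum]
  refine and_congr_right fun hJ => ⟨fun h A hA hl => ?_, fun h j _ => ?_⟩
  · obtain ⟨j, hj, rfl⟩ := π.eq_initial_of_lower hA hl
    rcases hj.lt_or_eq with hlt | rfl
    · exact h j hlt
    · rw [π.initial_of_length_le le_rfl, hJ]
  · exact h _ (π.initial_subset j) fun a b hab hb => π.initial_lower hab hb

lemma isStandard_iff :
    π.IsStandard ↔ ∃ a ∈ J, (∀ b ∈ J, a ≤ b) ∧ ∀ b ∈ J, π.rel a b := by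
  constructor
  · rintro ⟨S, hS, a, ha, hmin⟩
    have hlen : 0 < π.blocks.length := by
      by_contra h
      have : π.blocks = [] := List.eq_nil_of_length_eq_zero (by omega)
      simp [this] at hS
    have h0 : S = π.blocks[0] := by
      rw [List.head?_eq_getElem?, List.getElem?_eq_getElem hlen] at hS
      exact (Option.some.inj hS).symm
    rw [h0] at ha
    refine ⟨a, (π.mem_iff a).2 ⟨_, List.getElem_mem hlen, ha⟩, hmin, fun b hb => ?_⟩
    obtain ⟨j, hj, hbj⟩ := π.exists_mem_getElem hb
    exact (π.rel_iff_le ha hbj).2 (Nat.zero_le _)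
  · rintro ⟨a, ha, hmin, hrel⟩
    obtain ⟨i, hi, hai⟩ := π.exists_mem_getElem ha
    have hlen : 0 < π.blocks.length := by omega
    obtain ⟨b, hb⟩ := π.nonempty_of_mem _ (List.getElem_mem hlen)
    have := (π.rel_iff_le hai hb).1 (hrel b ((π.mem_iff b).2 ⟨_, List.getElem_mem hlen, hb⟩))
    obtain rfl : i = 0 := by omega
    exact ⟨_, by rw [List.head?_eq_getElem?, List.getElem?_eq_getElem hlen], a, hai, hmin⟩

lemma mem_blocks_iff {S : Finset (Fin n)} :
    S ∈ π.blocks ↔ ∃ a ∈ J, ∀ b, b ∈ S ↔ π.rel a b ∧ π.rel b a := by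
  constructor
  · intro hS
    obtain ⟨a, ha⟩ := π.nonempty_of_mem S hS
    obtain ⟨i, hi, rfl⟩ := List.getElem_of_mem hS
    refine ⟨a, (π.mem_iff a).2 ⟨_, hS, ha⟩, fun b => ⟨fun hb => ?_, fun hb => ?_⟩⟩
    · rw [π.rel_iff_le ha hb, π.rel_iff_le hb ha]
      exact ⟨le_rfl, le_rfl⟩
    · obtain ⟨j, hj, hbj⟩ := π.exists_mem_getElem hb.1.2.1
      rw [π.rel_iff_le ha hbj, π.rel_iff_le hbj ha] at hb
      obtain rfl : i = j := le_antisymm hb.1 hb.2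
      exact hbj
  · rintro ⟨a, ha, h⟩
    obtain ⟨i, hi, hai⟩ := π.exists_mem_getElem ha
    convert List.getElem_mem hi
    ext b
    rw [h]
    constructor
    · intro hb
      obtain ⟨j, hj, hbj⟩ := π.exists_mem_getElem hb.1.2.1
      rw [π.rel_iff_le hai hbj, π.rel_iff_le hbj hai] at hb
      obtain rfl : i = j := le_antisymm hb.1 hb.2
      exact hbj
    · intro hb
      rw [π.rel_iff_le hai hb, π.rel_iff_le hb hai]
      exact ⟨le_rfl, le_rfl⟩

lemma blocks_pairwise : π.blocks.Pairwise fun S T => ∀ a ∈ S, ∀ b ∈ T, ¬ π.rel b a := by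
  rw [List.pairwise_iff_getElem]
  intro i j hi hj hij a ha b hb
  rw [π.rel_iff_le hb ha]
  omega

/-- The preorder determines the blocks as tie classes and also their order, so the two block lists
are permutations of each other sorted by the same relation. -/
lemma eq_of_rel_eq {π π' : OrderedSetPartition J} (h : ∀ a b, π.rel a b ↔ π'.rel a b) : π = π' := by
  have hnd : ∀ π : OrderedSetPartition J, π.blocks.Nodup := fun π => by
    refine π.pairwise_disjoint.imp_of_mem fun {S T} hS _ hd he => ?_
    rw [he, disjoint_self] at hd
    exact (π.nonempty_of_mem S hS).ne_empty (he.trans hd)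
  have hmem : ∀ S, S ∈ π.blocks ↔ S ∈ π'.blocks := by
    intro S
    simp only [mem_blocks_iff, h]
  have hperm : π.blocks.Perm π'.blocks := (List.perm_ext_iff_of_nodup (hnd π) (hnd π')).2 hmem
  ext1
  refine hperm.eq_of_pairwise (le := fun S T => ∀ a ∈ S, ∀ b ∈ T, ¬ π.rel b a) ?_
    π.blocks_pairwise ?_
  · intro S T hS hT h₁ h₂
    exfalso
    obtain ⟨a, ha⟩ := π.nonempty_of_mem S hS
    obtain ⟨b, hb⟩ := π'.nonempty_of_mem T hT
    rcases π.rel_total ((π.mem_iff a).2 ⟨S, hS, ha⟩) ((π'.mem_iff b).2 ⟨T, hT, hb⟩) with h | h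
    · exact h₂ b hb a ha h
    · exact h₁ a ha b hb h
  · refine π'.blocks_pairwise.imp fun {S T} hST a ha b hb => ?_
    rw [h]
    exact hST a ha b hb

/-- The ordered set partition of `J` into the level sets of a function. -/
def ofLevels (f : Fin n → ℕ) (J : Finset (Fin n)) : OrderedSetPartition J where
  blocks := ((J.image f).sort (· ≤ ·)).map fun v => J.filter (f · = v)
  nonempty_of_mem S hS := by
    simp only [List.mem_map, Finset.mem_sort, Finset.mem_image] at hS
    obtain ⟨_, ⟨a, ha, rfl⟩, rfl⟩ := hS
    exact ⟨a, by simp [ha]⟩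
  pairwise_disjoint := by
    rw [List.pairwise_map]
    refine (Finset.sort_nodup _ _).imp fun {v w} hvw => ?_
    rw [Finset.disjoint_filter]
    rintro a - rfl h
    exact hvw h
  mem_iff a := by
    simp only [List.mem_map, Finset.mem_sort, Finset.mem_image]
    constructor
    · intro ha
      exact ⟨_, ⟨f a, ⟨a, ha, rfl⟩, rfl⟩, by simp [ha]⟩
    · rintro ⟨_, ⟨v, -, rfl⟩, ha⟩
      exact (Finset.mem_filter.1 ha).1

lemma ofLevels_rel (f : Fin n → ℕ) (J : Finset (Fin n)) (a b : Fin n) :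
    (ofLevels f J).rel a b ↔ a ∈ J ∧ b ∈ J ∧ f a ≤ f b := by
  by_cases ha : a ∈ J
  swap
  · simp [rel, ha]
  by_cases hb : b ∈ J
  swap
  · simp [rel, hb]
  obtain ⟨i, hi, hai⟩ := (ofLevels f J).exists_mem_getElem ha
  obtain ⟨j, hj, hbj⟩ := (ofLevels f J).exists_mem_getElem hb
  rw [rel_iff_le _ hai hbj]
  simp only [ofLevels, List.getElem_map, Finset.mem_filter] at hai hbj
  rw [hai.2, hbj.2]
  simp only [ha, hb, true_and]
  exact ((Finset.sortedLT_sort (J.image f)).strictMono_get.le_iff_le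
    (a := ⟨i, by simpa [ofLevels] using hi⟩) (b := ⟨j, by simpa [ofLevels] using hj⟩)).symm

end OrderedSetPartition

/-- The number of elements weakly below `a`. -/
def level {n : ℕ} (r : Fin n → Fin n → Prop) (a : Fin n) : ℕ := (Finset.univ.filter (r · a)).card

lemma level_le_iff {n : ℕ} {r : Fin n → Fin n → Prop} (hr : ∀ a, r a a)
    (ht : ∀ a b c, r a b → r b c → r a c) {a b : Fin n} (hab : r a b ∨ r b a) :
    level r a ≤ level r b ↔ r a b := by
  have hmono : ∀ {a b}, r a b → level r a ≤ level r b := fun h =>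
    Finset.card_le_card (Finset.monotone_filter_right _ fun c _ hc => ht c _ _ hc h)
  refine ⟨fun h => ?_, hmono⟩
  by_contra hn
  have hba := hab.resolve_left hn
  refine absurd h (not_le.2 (Finset.card_lt_card ?_))
  refine Finset.ssubset_iff_subset_ne.2
    ⟨Finset.monotone_filter_right _ fun c _ hc => ht c _ _ hc hba, fun he => hn ?_⟩
  have : a ∈ Finset.univ.filter (r · a) := by simp [hr]
  rw [← he] at this
  simpa using this

lemma eq_image_part {n : ℕ} (P : Finpartition (Finset.univ : Finset (Fin n))) :
    P.parts = Finset.univ.image P.part := by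
  ext J
  simp only [Finset.mem_image, Finset.mem_univ, true_and]
  constructor
  · intro hJ
    obtain ⟨a, ha⟩ := P.nonempty_of_mem_parts hJ
    exact ⟨a, P.part_eq_of_mem hJ ha⟩
  · rintro ⟨a, rfl⟩
    exact P.part_mem.2 (Finset.mem_univ a)

lemma card_image_eq_card_image {α β γ : Type*} [DecidableEq β] [DecidableEq γ] (s : Finset α)
    (f : α → β) (g : α → γ) (h : ∀ a ∈ s, ∀ b ∈ s, f a = f b ↔ g a = g b) :
    (s.image f).card = (s.image g).card := by
  have hf : s.image f = (s.image fun a => (f a, g a)).image Prod.fst := by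
    rw [Finset.image_image]; rfl
  have hg : s.image g = (s.image fun a => (f a, g a)).image Prod.snd := by
    rw [Finset.image_image]; rfl
  rw [hf, hg, Finset.card_image_of_injOn (f := Prod.fst), Finset.card_image_of_injOn (f := Prod.snd)]
  all_goals
    intro p hp p' hp' hpp
    simp only [Finset.coe_image, Set.mem_image, Finset.mem_coe] at hp hp'
    obtain ⟨a, ha, rfl⟩ := hp
    obtain ⟨b, hb, rfl⟩ := hp'
  · exact Prod.ext ((h a ha b hb).2 hpp) hpp
  · exact Prod.ext hpp ((h a ha b hb).1 hpp)

/-! ### Composite set partitions as preorders -/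

namespace CompositeSetPartition

variable {n : ℕ} (c : CompositeSetPartition n)

/-- The disjoint union of the total preorders of the constituents. -/
def rel (a b : Fin n) : Prop := ∃ J, (c.part J).rel a b

lemma eq_of_mem_mem {J K : {J // J ∈ c.supports.parts}} {a : Fin n} (h : a ∈ J.1) (h' : a ∈ K.1) :
    J = K := Subtype.ext (c.supports.eq_of_mem_parts J.2 K.2 h h')

lemma exists_mem (a : Fin n) : ∃ J : {J // J ∈ c.supports.parts}, a ∈ J.1 := by
  obtain ⟨J, hJ, ha⟩ := c.supports.exists_mem (Finset.mem_univ a)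
  exact ⟨⟨J, hJ⟩, ha⟩

lemma rel_iff_left {J : {J // J ∈ c.supports.parts}} {a b : Fin n} (h : a ∈ J.1) :
    c.rel a b ↔ (c.part J).rel a b := by
  constructor
  · rintro ⟨K, hK⟩
    rwa [c.eq_of_mem_mem h hK.1]
  · exact fun h => ⟨J, h⟩

lemma rel_iff_right {J : {J // J ∈ c.supports.parts}} {a b : Fin n} (h : b ∈ J.1) :
    c.rel a b ↔ (c.part J).rel a b := by
  constructor
  · rintro ⟨K, hK⟩
    rwa [c.eq_of_mem_mem h hK.2.1]
  · exact fun h => ⟨J, h⟩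

lemma rel_refl (a : Fin n) : c.rel a a := by
  obtain ⟨J, hJ⟩ := c.exists_mem a
  exact ⟨J, by simpa using (c.part J).rel_total hJ hJ⟩

lemma rel_trans {a b d : Fin n} (h : c.rel a b) (h' : c.rel b d) : c.rel a d := by
  obtain ⟨J, hJ⟩ := h
  exact ⟨J, (c.part J).rel_trans hJ ((c.rel_iff_left hJ.2.1).1 h')⟩

lemma mem_iff_comparable {J : {J // J ∈ c.supports.parts}} {a : Fin n} (h : a ∈ J.1) (b : Fin n) :
    b ∈ J.1 ↔ c.rel a b ∨ c.rel b a := by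
  constructor
  · intro hb
    exact ((c.part J).rel_total h hb).imp (fun h => ⟨J, h⟩) fun h => ⟨J, h⟩
  · rintro (hab | hba)
    · exact ((c.rel_iff_left h).1 hab).2.1
    · exact ((c.rel_iff_right h).1 hba).1

/-- The cone of a composite set partition is cut out by the lower sets of its preorder. -/
lemma mem_cone_iff (x : Fin n → ℝ) :
    x ∈ c.cone ↔ ∑ i, x i = 0 ∧ ∀ A ∈ lowerSets c.rel, 0 ≤ ∑ i ∈ A, x i := by
  rw [cone, Set.mem_fintype_sum]
  simp only [OrderedSetPartition.mem_plate_iff]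
  constructor
  · rintro ⟨g, hg, rfl⟩
    have hsum : ∀ A : Finset (Fin n), ∑ i ∈ A, (∑ J, g J) i =
        ∑ J : {J // J ∈ c.supports.parts}, ∑ i ∈ A ∩ J.1, g J i := by
      intro A
      simp only [Finset.sum_apply]
      rw [Finset.sum_comm]
      refine Finset.sum_congr rfl fun J _ => (Finset.sum_subset Finset.inter_subset_left ?_).symm
      intro i hi hiJ
      exact (hg J).1 i fun h => hiJ (Finset.mem_inter.2 ⟨hi, h⟩)
    constructor
    · rw [hsum]
      refine Finset.sum_eq_zero fun J _ => ?_
      rw [Finset.univ_inter]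
      exact (hg J).2.1
    · intro A hA
      rw [hsum]
      refine Finset.sum_nonneg fun J _ => (hg J).2.2 _ Finset.inter_subset_right ?_
      intro a b hab hb
      rw [Finset.mem_inter] at hb ⊢
      exact ⟨(mem_lowerSets.1 hA).2.2 a b ⟨J, hab⟩ hb.1, hab.1⟩
  · rintro ⟨h0, hA⟩
    have hlow : ∀ A : Finset (Fin n), (∀ a b, c.rel a b → b ∈ A → a ∈ A) →
        0 ≤ ∑ i ∈ A, x i := by
      intro A hl
      rcases A.eq_empty_or_nonempty with rfl | hne
      · simp
      · by_cases hu : A = Finset.univ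
        · rw [hu, h0]
        · exact hA A (mem_lowerSets.2 ⟨hne, hu, hl⟩)
    -- Decompose `x` into its restrictions to the supports. Each restriction has sum zero because
    -- both `J` and its complement are lower sets, with sums adding up to zero.
    refine ⟨fun J i => if i ∈ J.1 then x i else 0, fun J => ⟨fun i hi => if_neg hi, ?_, ?_⟩, ?_⟩
    · rw [Finset.sum_congr rfl fun i hi => if_pos hi]
      have h1 : 0 ≤ ∑ i ∈ J.1, x i := hlow _ fun a b hab hb => ((c.rel_iff_right hb).1 hab).1
      have h2 : 0 ≤ ∑ i ∈ J.1ᶜ, x i := hlow _ fun a b hab hb => by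
        rw [Finset.mem_compl] at hb ⊢
        exact fun ha => hb ((c.rel_iff_left ha).1 hab).2.1
      have := Finset.sum_add_sum_compl J.1 x
      linarith
    · intro A hAJ hl
      rw [Finset.sum_congr rfl fun i hi => if_pos (hAJ hi)]
      exact hlow A fun a b hab hb => hl a b ((c.rel_iff_right (hAJ hb)).1 hab) hb
    · funext i
      rw [Finset.sum_apply]
      obtain ⟨J, hJ⟩ := c.exists_mem i
      rw [Finset.sum_eq_single J]
      · rw [if_pos hJ]
      · intro K _ hK
        exact if_neg fun h => hK (c.eq_of_mem_mem h hJ)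
      · simp

lemma charFun_cone : charFun c.cone = cutFun (lowerSets c.rel) := by
  funext x
  by_cases hx : x ∈ c.cone
  · rw [charFun, Set.indicator_of_mem hx, cutFun, if_pos ((c.mem_cone_iff x).1 hx)]
    rfl
  · rw [charFun, Set.indicator_of_notMem hx, cutFun, if_neg fun h => hx ((c.mem_cone_iff x).2 h)]

/-- Equal prefix minima always force a common component; the converse says that the least label of
each component precedes the whole component. -/
lemma isStandard_iff : c.IsStandard ↔ IsStandardRel c.rel := by
  have hmem : ∀ a b, prefixMin c.rel a = prefixMin c.rel b → c.rel a b ∨ c.rel b a := by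
    intro a b hab
    obtain ⟨J, hJ⟩ := c.exists_mem (prefixMin c.rel a)
    have ha := ((c.rel_iff_left hJ).1 (prefixMin_rel c.rel_refl a)).2.1
    have hb := ((c.rel_iff_left (hab ▸ hJ)).1 (prefixMin_rel c.rel_refl b)).2.1
    exact (c.mem_iff_comparable ha b).1 hb
  constructor
  · intro hc
    have hmin : ∀ J : {J // J ∈ c.supports.parts}, ∃ m, ∀ a ∈ J.1, prefixMin c.rel a = m := by
      intro J
      obtain ⟨m, hm, hle, hrel⟩ := (c.part J).isStandard_iff.1 (hc J)
      refine ⟨m, fun a ha => le_antisymm (prefixMin_le ⟨J, hrel a ha⟩) ?_⟩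
      exact le_prefixMin c.rel_refl fun b hb => hle b ((c.rel_iff_right ha).1 hb).1
    refine ⟨c.rel_refl, fun _ _ _ => c.rel_trans, fun a b => ⟨hmem a b, fun h => ?_⟩⟩
    obtain ⟨J, hJ⟩ := c.exists_mem a
    obtain ⟨m, hm⟩ := hmin J
    rw [hm a hJ, hm b ((c.mem_iff_comparable hJ b).2 h)]
  · intro hc J
    rw [OrderedSetPartition.isStandard_iff]
    obtain ⟨a, ha⟩ := c.supports.nonempty_of_mem_parts J.2
    refine ⟨prefixMin c.rel a, ((c.rel_iff_right ha).1 (prefixMin_rel c.rel_refl a)).1, ?_, ?_⟩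
    all_goals
      intro b hb
      rw [(hc.eq_iff a b).2 ((c.mem_iff_comparable ha b).1 hb)]
    · exact prefixMin_le_self _ _
    · exact (c.rel_iff_right hb).1 (prefixMin_rel c.rel_refl b)

lemma numParts_eq (hc : IsStandardRel c.rel) :
    c.numParts = (Finset.univ.image (prefixMin c.rel)).card := by
  rw [numParts, eq_image_part]
  refine card_image_eq_card_image _ _ _ fun a _ b _ => ?_
  rw [hc.eq_iff]
  obtain ⟨J, hJ⟩ := c.exists_mem a
  rw [c.supports.part_eq_of_mem J.2 hJ, ← c.mem_iff_comparable hJ, eq_comm,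
    c.supports.part_eq_iff_mem J.2]

lemma eq_of_rel_eq {c c' : CompositeSetPartition n} (h : c.rel = c'.rel) : c = c' := by
  have hs : c.supports = c'.supports := by
    have key : ∀ c c' : CompositeSetPartition n, c.rel = c'.rel →
        c.supports.parts ⊆ c'.supports.parts := by
      intro c c' h J hJ
      obtain ⟨a, ha⟩ := c.supports.nonempty_of_mem_parts hJ
      obtain ⟨K, hK⟩ := c'.exists_mem a
      convert K.2
      ext b
      rw [c.mem_iff_comparable (J := ⟨J, hJ⟩) ha, c'.mem_iff_comparable hK, h]
    exact Finpartition.ext ((key c c' h).antisymm (key c' c h.symm))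
  have hp : ∀ (J : Finset (Fin n)) (hJ : J ∈ c.supports.parts) (hJ' : J ∈ c'.supports.parts),
      c.part ⟨J, hJ⟩ = c'.part ⟨J, hJ'⟩ := by
    intro J hJ hJ'
    refine OrderedSetPartition.eq_of_rel_eq fun a b => ?_
    by_cases ha : a ∈ J
    · rw [← c.rel_iff_left (J := ⟨J, hJ⟩) ha, h, c'.rel_iff_left (J := ⟨J, hJ'⟩) ha]
    · simp [OrderedSetPartition.rel, ha]
  obtain ⟨s, p⟩ := c
  obtain ⟨s', p'⟩ := c'
  obtain rfl : s = s' := hs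
  congr 1
  funext J
  exact hp J.1 J.2 J.2

lemma exists_rel_eq {q : Fin n → Fin n → Prop} (hq : IsStandardRel q) :
    ∃ c : CompositeSetPartition n, c.rel = q := by
  refine ⟨⟨Finpartition.ofSetoid (Setoid.ker (prefixMin q)),
    fun J => OrderedSetPartition.ofLevels (level q) J.1⟩, ?_⟩
  funext a b
  simp only [rel, OrderedSetPartition.ofLevels_rel, eq_iff_iff]
  constructor
  · rintro ⟨J, ha, hb, hab⟩
    refine (level_le_iff hq.refl hq.trans ((hq.eq_iff a b).1 ?_)).1 hab
    rw [← Finpartition.part_eq_of_mem _ J.2 ha, Finpartition.mem_part_ofSetoid_iff_rel] at hb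
    exact hb
  · intro hab
    refine ⟨⟨_, (Finpartition.part_mem _).2 (Finset.mem_univ a)⟩,
      (Finpartition.mem_part_self _).2 (Finset.mem_univ a), ?_,
      (level_le_iff hq.refl hq.trans (Or.inl hab)).2 hab⟩
    rw [Finpartition.mem_part_ofSetoid_iff_rel]
    exact hq.prefixMin_eq hab

end CompositeSetPartition

/-! ### Bases of the plate space and of its pointed quotient -/

section Cones

variable {n : ℕ}

/-- A tie between `a` and `b` gives a line in direction `e_a - e_b`. Without ties, the sum of a line
direction over every lower set vanishes, and deleting `a` from its principal lower set leaves a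
lower set, which isolates the coordinate at `a`. -/
lemma isPointed_iff {r : Fin n → Fin n → Prop} (hr : ∀ a, r a a)
    (ht : ∀ a b c, r a b → r b c → r a c) {C : Set (Fin n → ℝ)}
    (hC : ∀ x, x ∈ C ↔ ∑ i, x i = 0 ∧ ∀ A ∈ lowerSets r, 0 ≤ ∑ i ∈ A, x i) :
    IsPointed C ↔ ∀ a b, r a b → r b a → a = b := by
  constructor
  · intro hp a b hab hba
    by_contra hne
    refine hp ⟨0, Pi.single a 1 - Pi.single b 1, fun h => ?_, fun t => (hC _).2 ⟨?_, ?_⟩⟩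
    · have := congrFun h a
      simp [hne] at this
    · rw [sum_translate]
      simp
    · intro A hA
      rw [sum_translate]
      have : a ∈ A ↔ b ∈ A := ⟨(mem_lowerSets.1 hA).2.2 b a hba, (mem_lowerSets.1 hA).2.2 a b hab⟩
      simp [this]
  · rintro hanti ⟨x, v, hv, hline⟩
    refine hv ?_
    have hlow : ∀ A : Finset (Fin n), (∀ a b, r a b → b ∈ A → a ∈ A) → ∑ i ∈ A, v i = 0 := by
      intro A hl
      have hexp : ∀ t : ℝ, ∑ i ∈ A, (x + t • v) i = ∑ i ∈ A, x i + t * ∑ i ∈ A, v i := by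
        intro t
        simp [Finset.sum_add_distrib, Finset.mul_sum]
      have hnn : ∀ t : ℝ, 0 ≤ ∑ i ∈ A, x i + t * ∑ i ∈ A, v i := by
        intro t
        rw [← hexp]
        rcases A.eq_empty_or_nonempty with rfl | hne
        · simp
        · by_cases hu : A = Finset.univ
          · rw [hu, ((hC _).1 (hline t)).1]
          · exact ((hC _).1 (hline t)).2 A (mem_lowerSets.2 ⟨hne, hu, hl⟩)
      by_contra hne
      -- This value of `t` makes the sum over `A` equal to `-1`.
      have := hnn (-(∑ i ∈ A, x i + 1) / ∑ i ∈ A, v i)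
      rw [div_mul_cancel₀ _ hne] at this
      linarith
    funext a
    have h₁ := hlow (Finset.univ.filter (r · a)) fun b c hbc hc => by
      simp at hc ⊢
      exact ht _ _ _ hbc hc
    have h₂ := hlow ((Finset.univ.filter (r · a)).erase a) fun b c hbc hc => by
      simp at hc ⊢
      refine ⟨fun hba => hc.1 (hanti c a hc.2 (hba ▸ hbc)), ht _ _ _ hbc hc.2⟩
    rw [← Finset.add_sum_erase _ _ (show a ∈ Finset.univ.filter (r · a) by simp [hr]), h₂] at h₁
    simpa using h₁

lemma CompositeSetPartition.isPointed_cone_iff (c : CompositeSetPartition n) :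
    IsPointed c.cone ↔ ∀ a b, c.rel a b → c.rel b a → a = b :=
  isPointed_iff c.rel_refl (fun _ _ _ => c.rel_trans) c.mem_cone_iff

namespace OrderedSetPartition

variable (π : OrderedSetPartition (Finset.univ : Finset (Fin n)))

lemma isWeakOrder_rel : IsWeakOrder π.rel :=
  ⟨fun _ _ => π.rel_total (Finset.mem_univ _) (Finset.mem_univ _), fun _ _ _ => π.rel_trans⟩

lemma mem_plate_univ_iff (x : Fin n → ℝ) :
    x ∈ π.plate ↔ ∑ i, x i = 0 ∧ ∀ A ∈ lowerSets π.rel, 0 ≤ ∑ i ∈ A, x i := by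
  rw [mem_plate_iff]
  simp only [Finset.mem_univ, not_true_eq_false, false_imp_iff, implies_true, true_and,
    Finset.subset_univ, forall_const]
  refine and_congr_right fun h0 => ⟨fun h A hA => h A (mem_lowerSets.1 hA).2.2, fun h A hl => ?_⟩
  rcases A.eq_empty_or_nonempty with rfl | hne
  · simp
  · by_cases hu : A = Finset.univ
    · rw [hu, h0]
    · exact h A (mem_lowerSets.2 ⟨hne, hu, hl⟩)

lemma charFun_plate : charFun π.plate = cutFun (lowerSets π.rel) := by
  funext x
  by_cases hx : x ∈ π.plate
  · rw [charFun, Set.indicator_of_mem hx, cutFun, if_pos ((π.mem_plate_univ_iff x).1 hx)]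
    rfl
  · rw [charFun, Set.indicator_of_notMem hx, cutFun,
      if_neg fun h => hx ((π.mem_plate_univ_iff x).2 h)]

lemma isPointed_plate_iff : IsPointed π.plate ↔ ∀ a b, π.rel a b → π.rel b a → a = b :=
  isPointed_iff π.isWeakOrder_rel.refl π.isWeakOrder_rel.trans π.mem_plate_univ_iff

lemma exists_rel_eq {r : Fin n → Fin n → Prop} (hr : IsWeakOrder r) :
    ∃ π : OrderedSetPartition (Finset.univ : Finset (Fin n)), π.rel = r := by
  refine ⟨ofLevels (level r) Finset.univ, ?_⟩
  funext a b
  simp only [ofLevels_rel, Finset.mem_univ, true_and, eq_iff_iff]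
  exact level_le_iff hr.refl hr.trans (hr.total a b)

end OrderedSetPartition

lemma isWeakOrder_flagRel (σ : Flag (Fin n)) : IsWeakOrder (flagRel σ.1) :=
  ⟨flagRel_total σ.2.1, fun _ _ _ => flagRel_trans⟩

lemma plateSpace_eq : plateSpace n = flagSpace (Fin n) := by
  rw [plateSpace, flagSpace]
  congr 1
  ext f
  constructor
  · rintro ⟨π, rfl⟩
    exact ⟨⟨_, isFlag_lowerSets π.isWeakOrder_rel.total⟩, π.charFun_plate.symm⟩
  · rintro ⟨σ, rfl⟩
    obtain ⟨π, hπ⟩ := OrderedSetPartition.exists_rel_eq (isWeakOrder_flagRel σ)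
    exact ⟨π, by rw [π.charFun_plate, hπ, lowerSets_flagRel σ.2]⟩

/-- The type of standard composite set partitions. -/
abbrev StandardComposite (n : ℕ) : Type := {c : CompositeSetPartition n // c.IsStandard}

instance : Finite (CompositeSetPartition n) :=
  Finite.of_injective (fun c => c.rel) fun _ _ => CompositeSetPartition.eq_of_rel_eq

lemma StandardComposite.isStandardRel (c : StandardComposite n) : IsStandardRel c.1.rel :=
  c.1.isStandard_iff.1 c.2

/-- Standard composite set partitions correspond to weak orders. -/
def weakOrderEquiv (n : ℕ) :
    StandardComposite n ≃ {r : Fin n → Fin n → Prop // IsWeakOrder r} :=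
  Equiv.ofBijective (fun c => ⟨concat c.1.rel, c.isStandardRel.isWeakOrder_concat⟩) (by
    constructor
    · intro c c' h
      refine Subtype.ext (CompositeSetPartition.eq_of_rel_eq ?_)
      rw [← c.isStandardRel.cut_concat, ← c'.isStandardRel.cut_concat]
      exact congrArg cut (congrArg Subtype.val h)
    · rintro ⟨r, hr⟩
      obtain ⟨c, hc⟩ := CompositeSetPartition.exists_rel_eq hr.isStandardRel_cut
      exact ⟨⟨c, c.isStandard_iff.2 (hc ▸ hr.isStandardRel_cut)⟩,
        Subtype.ext (by simp only [hc, hr.concat_cut])⟩)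

lemma weakOrderEquiv_apply (c : StandardComposite n) :
    (weakOrderEquiv n c).1 = concat c.1.rel := rfl

/-- The flag of a standard composite set partition. -/
def StandardComposite.flag (c : StandardComposite n) : Flag (Fin n) :=
  ⟨lowerSets (concat c.1.rel), isFlag_lowerSets c.isStandardRel.isWeakOrder_concat.total⟩

lemma StandardComposite.flagRel_flag (c : StandardComposite n) (a b : Fin n) :
    flagRel c.flag.1 a b ↔ concat c.1.rel a b :=
  flagRel_lowerSets c.isStandardRel.isWeakOrder_concat.refl
    c.isStandardRel.isWeakOrder_concat.trans

/-- Only this inequality is needed: it turns the independence of the cone vectors into spanning. -/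
lemma card_flag_le : Nat.card (Flag (Fin n)) ≤ Nat.card (StandardComposite n) := by
  rw [Nat.card_congr (weakOrderEquiv n)]
  refine Nat.card_le_card_of_injective (fun σ => ⟨flagRel σ.1, isWeakOrder_flagRel σ⟩) ?_
  intro σ τ h
  apply Subtype.ext
  rw [← lowerSets_flagRel σ.2, ← lowerSets_flagRel τ.2]
  exact congrArg lowerSets (congrArg Subtype.val h)

/-- The characteristic function of the cone of a standard composite set partition. -/
def coneVector (c : StandardComposite n) : plateSpace n :=
  ⟨charFun c.1.cone, by rw [c.1.charFun_cone, plateSpace_eq]; exact cutFun_lowerSets_mem _⟩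

/-- The coefficient functionals with respect to the open dual cones. -/
def flagCoord (σ : Flag (Fin n)) : plateSpace n →ₗ[ℂ] ℂ :=
  ((openBasis (Fin n)).coord σ).comp (LinearEquiv.ofEq _ _ plateSpace_eq).toLinearMap

lemma flagCoord_apply (σ : Flag (Fin n)) (r : Fin n → Fin n → Prop) (f : plateSpace n)
    [Decidable (∀ a b, r a b → flagRel σ.1 a b)]
    (hf : (f : (Fin n → ℝ) → ℂ) = cutFun (lowerSets r)) :
    flagCoord σ f = if ∀ a b, r a b → flagRel σ.1 a b then 1 else 0 :=
  openBasis_coord r σ _ hf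

lemma flagCoord_coneVector (c c' : StandardComposite n) : flagCoord c.flag (coneVector c') =
    if ∀ a b, c'.1.rel a b → concat c.1.rel a b then 1 else 0 := by
  rw [flagCoord_apply c.flag c'.1.rel _ c'.1.charFun_cone]
  simp only [c.flagRel_flag]

lemma flagCoord_coneVector_self (c : StandardComposite n) :
    flagCoord c.flag (coneVector c) ≠ 0 := by
  rw [flagCoord_coneVector, if_pos]
  · exact one_ne_zero
  · exact fun a b h => Or.inr h

lemma eq_or_relKey_lt_of_flagCoord_ne_zero (c c' : StandardComposite n)
    (h : flagCoord c.flag (coneVector c') ≠ 0) : c' = c ∨ relKey c.1.rel < relKey c'.1.rel := by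
  rw [flagCoord_coneVector] at h
  have hsub : ∀ a b, c'.1.rel a b → concat c.1.rel a b := by
    by_contra hn
    exact h (if_neg hn)
  exact (c.isStandardRel.eq_or_relKey_lt c'.isStandardRel hsub).imp
    (fun h => Subtype.ext (CompositeSetPartition.eq_of_rel_eq h)) id

theorem linearIndependent_coneVector :
    LinearIndependent ℂ (coneVector : StandardComposite n → plateSpace n) :=
  linearIndependent_of_triangular _ (fun c => flagCoord c.flag) (fun c => relKey c.1.rel)
    flagCoord_coneVector_self eq_or_relKey_lt_of_flagCoord_ne_zero

theorem span_coneVector :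
    Submodule.span ℂ (Set.range (coneVector : StandardComposite n → plateSpace n)) = ⊤ := by
  have : Fintype (StandardComposite n) := Fintype.ofFinite _
  have hfd : FiniteDimensional ℂ (plateSpace n) := by rw [plateSpace_eq]; infer_instance
  refine Submodule.eq_top_of_finrank_eq (le_antisymm (Submodule.finrank_le _) ?_)
  rw [finrank_span_eq_card linearIndependent_coneVector, plateSpace_eq, finrank_flagSpace,
    ← Nat.card_eq_fintype_card, ← Nat.card_eq_fintype_card]
  exact card_flag_le

/-- The type of pointed standard composite set partitions. -/
abbrev PointedComposite (n : ℕ) : Type := {c : StandardComposite n // IsPointed c.1.cone}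

/-- The class of the characteristic function of a pointed cone. -/
def pointedVector (c : PointedComposite n) : PointedPlateSpace n :=
  (nonpointedSpace n).mkQ (coneVector c.1)

/-- A pointed composite concatenates to a linear order, which cannot contain the total preorder of a
plate with ties. Hence these functionals descend to the quotient. -/
lemma nonpointedSpace_le_ker_flagCoord (c : PointedComposite n) :
    nonpointedSpace n ≤ LinearMap.ker (flagCoord c.1.flag) := by
  rw [nonpointedSpace, Submodule.span_le]
  rintro f ⟨π, hπ, hf⟩
  rw [SetLike.mem_coe, LinearMap.mem_ker, flagCoord_apply _ π.rel f (hf.trans π.charFun_plate),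
    if_neg]
  intro hsub
  refine hπ (π.isPointed_plate_iff.2 fun a b hab hba => ?_)
  have hanti := c.1.isStandardRel.concat_antisymm_iff.2 (c.1.1.isPointed_cone_iff.1 c.2)
  exact hanti a b ((c.1.flagRel_flag a b).1 (hsub a b hab)) ((c.1.flagRel_flag b a).1 (hsub b a hba))

theorem linearIndependent_pointedVector :
    LinearIndependent ℂ (pointedVector : PointedComposite n → PointedPlateSpace n) := by
  refine linearIndependent_of_triangular _
    (fun c => (nonpointedSpace n).liftQ _ (nonpointedSpace_le_ker_flagCoord c))
    (fun c => relKey c.1.1.rel) (fun c => ?_) (fun c c' h => ?_)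
  · rw [pointedVector, Submodule.mkQ_apply, Submodule.liftQ_apply]
    exact flagCoord_coneVector_self c.1
  · rw [pointedVector, Submodule.mkQ_apply, Submodule.liftQ_apply] at h
    exact (eq_or_relKey_lt_of_flagCoord_ne_zero c.1 c'.1 h).imp Subtype.ext id

lemma coneVector_mem_nonpointedSpace (c : StandardComposite n) (hc : ¬ IsPointed c.1.cone) :
    coneVector c ∈ nonpointedSpace n := by
  rw [c.1.isPointed_cone_iff] at hc
  push Not at hc
  obtain ⟨a, b, hab, hba, hne⟩ := hc
  -- expand into open dual cones of flags, then into plates, all with `a` and `b` in one block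
  have hplate : ∀ τ : Flag (Fin n), flagRel τ.1 a b → flagRel τ.1 b a →
      ∃ f ∈ nonpointedSpace n, (f : (Fin n → ℝ) → ℂ) = cutFun τ.1 := by
    intro τ h₁ h₂
    obtain ⟨π, hπ⟩ := OrderedSetPartition.exists_rel_eq (isWeakOrder_flagRel τ)
    have hf : charFun π.plate = cutFun τ.1 := by
      rw [π.charFun_plate, hπ, lowerSets_flagRel τ.2]
    refine ⟨⟨charFun π.plate, Submodule.subset_span ⟨π, rfl⟩⟩,
      Submodule.subset_span ⟨π, fun hp => hne ?_, rfl⟩, hf⟩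
    exact π.isPointed_plate_iff.1 hp a b (hπ ▸ h₁) (hπ ▸ h₂)
  have hmem : cutFun (lowerSets c.1.rel) ∈
      (nonpointedSpace n).map (plateSpace n).subtype := by
    rw [cutFun_lowerSets_eq_sum]
    refine Submodule.sum_mem _ fun σ _ => ?_
    split_ifs with hσ
    swap
    · simp
    rw [one_smul, coe_openBasis]
    -- Passing to a subflag only merges blocks, so `a` and `b` remain tied.
    refine openFun_mem_of_cutFun_mem fun τ hτ => ?_
    obtain ⟨f, hf, hfτ⟩ := hplate ⟨τ, σ.2.mono hτ⟩ (fun A hA => hσ a b hab A (hτ hA))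
      (fun A hA => hσ b a hba A (hτ hA))
    exact ⟨f, hf, hfτ⟩
  obtain ⟨f, hf, hfc⟩ := hmem
  have : coneVector c = f := Subtype.ext (c.1.charFun_cone.trans hfc.symm)
  rw [this]
  exact hf

theorem span_pointedVector :
    Submodule.span ℂ (Set.range (pointedVector : PointedComposite n → PointedPlateSpace n)) = ⊤ := by
  rw [eq_top_iff, ← Submodule.range_mkQ (nonpointedSpace n), LinearMap.range_eq_map,
    ← span_coneVector, Submodule.map_span, Submodule.span_le]
  rintro _ ⟨_, ⟨c, rfl⟩, rfl⟩
  by_cases hc : IsPointed c.1.cone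
  · exact Submodule.subset_span ⟨⟨c, hc⟩, rfl⟩
  · rw [Submodule.mkQ_apply, (Submodule.Quotient.mk_eq_zero _).2 (coneVector_mem_nonpointedSpace c hc)]
    exact Submodule.zero_mem _

end Cones

/-! ### Generating function of the number of cycles -/

section Cycles

open Equiv Equiv.Perm

/-- The number of cycles of a permutation, fixed points included. -/
def numCycles {α : Type*} [Fintype α] [DecidableEq α] (σ : Perm α) : ℕ := σ.partition.parts.card

lemma numCycles_eq {α : Type*} [Fintype α] [DecidableEq α] (σ : Perm α) :
    numCycles σ = σ.cycleType.card + (Fintype.card α - σ.cycleType.sum) := by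
  simp [numCycles, parts_partition, sum_cycleType]

/-- Multiplying by the transposition inserts the fixed point `x` into the cycle of `y`, so the
trivial cycle of `x` disappears. -/
lemma numCycles_swap_mul {α : Type*} [Fintype α] [DecidableEq α] {g : Perm α} {x y : α}
    (hx : g x = x) (hxy : x ≠ y) : numCycles (swap x y * g) + 1 = numCycles g := by
  have hle := sum_cycleType_le (swap x y * g)
  by_cases hy : g y = y
  · have hd : Disjoint (swap x y) g := by
      intro z
      by_cases hz : z = x ∨ z = y
      · right
        rcases hz with rfl | rfl
        · exact hx
        · exact hy
      · push Not at hz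
        exact Or.inl (swap_apply_of_ne_of_ne hz.1 hz.2)
    have hsw : (swap x y).cycleType = {2} := isSwap_iff_cycleType.1 ⟨x, y, hxy, rfl⟩
    rw [numCycles_eq, numCycles_eq]
    rw [hd.cycleType_mul, hsw] at hle ⊢
    simp at hle ⊢
    omega
  · set c := g.cycleOf y with hc
    have hcF : c ∈ g.cycleFactorsFinset :=
      cycleOf_mem_cycleFactorsFinset_iff.2 (mem_support.2 hy)
    have hcyc : c.IsCycle := isCycle_cycleOf g hy
    have hdis : Disjoint (g * c⁻¹) c := disjoint_mul_inv_of_mem_cycleFactorsFinset hcF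
    set h := g * c⁻¹ with hh
    have hg : g = h * c := by rw [hh, inv_mul_cancel_right]
    have hcx : c x = x := by
      by_contra hcx
      have : x ∈ g.support := support_cycleOf_le g y (mem_support.2 hcx)
      exact mem_support.1 this hx
    have hhx : h x = x := by
      rw [hh, mul_apply, inv_eq_iff_eq.2 hcx.symm, hx]
    have hymem : y ∈ g.support := mem_support.2 hy
    have hpos := length_toList_pos_of_mem_support (p := g) (x := y) hymem
    obtain ⟨t, ht⟩ : ∃ t, toList g y = y :: t := by
      cases hl : toList g y with
      | nil => simp [hl] at hpos
      | cons z t =>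
        have := toList_getElem_zero (p := g) (x := y) hymem
        simp only [hl, List.getElem_cons_zero] at this
        exact ⟨t, by rw [this]⟩
    -- The list `y :: t` traverses the cycle of `y`; prepending `x` describes the lengthened cycle.
    have hnodup : (x :: y :: t).Nodup := by
      rw [← ht, List.nodup_cons]
      refine ⟨fun hm => ?_, nodup_toList g y⟩
      exact hy ((mem_toList_iff.1 hm).1.apply_eq_self_iff.2 hx)
    have hform : swap x y * c = List.formPerm (x :: y :: t) := by
      rw [List.formPerm_cons_cons, ← ht, formPerm_toList]
    have hcyc' : (swap x y * c).IsCycle := by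
      rw [hform]
      exact List.isCycle_formPerm hnodup (by simp)
    have hsupp' : (swap x y * c).support.card = c.support.card + 1 := by
      rw [hform, List.support_formPerm_of_nodup _ hnodup (by simp),
        List.toFinset_card_of_nodup hnodup, List.length_cons, ← ht, length_toList]
    have hdis' : Disjoint (swap x y * c) h := by
      intro z
      rcases hdis z with hz | hz
      · exact Or.inr hz
      · by_cases hzx : z = x
        · right; rw [hzx, hhx]
        · by_cases hzy : z = y
          · exact absurd (by rw [hzy, hc, cycleOf_apply_self] at hz; exact hz) hy
          · left; rw [mul_apply, hz, swap_apply_of_ne_of_ne hzx hzy]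
    have e1 : (swap x y * g).cycleType = {c.support.card + 1} + h.cycleType := by
      rw [hg, hdis.commute.eq, ← mul_assoc, hdis'.cycleType_mul, hcyc'.cycleType, hsupp']
    have e2 : g.cycleType = {c.support.card} + h.cycleType := by
      conv_lhs => rw [hg, hdis.commute.eq, hdis.symm.cycleType_mul, hcyc.cycleType]
    rw [numCycles_eq, numCycles_eq]
    rw [e1] at hle ⊢
    rw [e2]
    simp at hle ⊢
    omega

lemma decomposeFin_symm_zero {n : ℕ} (e : Perm (Fin n)) :
    decomposeFin.symm (0, e) = e.extendDomain (finSuccAboveEquiv 0) := by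
  ext i
  refine Fin.cases ?_ (fun i => ?_) i
  · rw [decomposeFin_symm_apply_zero, extendDomain_apply_not_subtype _ _ (by simp)]
  · have := extendDomain_apply_image e (finSuccAboveEquiv (0 : Fin (n + 1))) i
    simp only [finSuccAboveEquiv_apply, Fin.zero_succAbove] at this
    rw [this]
    simp

lemma numCycles_decomposeFin_zero {n : ℕ} (e : Perm (Fin n)) :
    numCycles (decomposeFin.symm (0, e)) = numCycles e + 1 := by
  have := sum_cycleType_le e
  rw [decomposeFin_symm_zero, numCycles_eq, numCycles_eq, cycleType_extendDomain]
  simp at this ⊢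
  omega

lemma numCycles_decomposeFin_succ {n : ℕ} (e : Perm (Fin n)) (p : Fin n) :
    numCycles (decomposeFin.symm (p.succ, e)) = numCycles e := by
  have hmul : decomposeFin.symm (p.succ, e) = swap 0 p.succ * decomposeFin.symm (0, e) := by
    ext i
    refine Fin.cases ?_ (fun i => ?_) i <;> simp
  have := numCycles_swap_mul (g := decomposeFin.symm (0, e)) (x := 0) (y := p.succ) (by simp)
    (Fin.succ_ne_zero p).symm
  rw [← hmul, numCycles_decomposeFin_zero] at this
  omega

open Polynomial in
/-- The generating function of the number of cycles is the rising factorial. -/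
theorem sum_X_pow_numCycles (n : ℕ) :
    ∑ σ : Perm (Fin n), (X : ℕ[X]) ^ numCycles σ = ∏ j : Fin n, (X + (j : ℕ[X])) := by
  induction n with
  | zero =>
    simp [numCycles_eq]
  | succ n ih =>
    rw [Fin.prod_univ_castSucc, ← decomposeFin.symm.sum_comp, Fintype.sum_prod_type_right]
    simp only [Fin.sum_univ_succ, numCycles_decomposeFin_zero, numCycles_decomposeFin_succ]
    simp only [Fin.val_castSucc, Fin.val_last, ← ih, Finset.sum_mul]
    refine Finset.sum_congr rfl fun σ _ => ?_
    simp
    ring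

end Cycles

/-! ### Generating function of the number of records -/

section Records

/-- The linear order on `Fin m` pulled back along a permutation. -/
def permRel {m : ℕ} (p : Equiv.Perm (Fin m)) (a b : Fin m) : Prop := p a ≤ p b

/-- The number of values of the prefix minimum. -/
def numRecords {m : ℕ} (r : Fin m → Fin m → Prop) : ℕ := (Finset.univ.image (prefixMin r)).card

lemma isWeakOrder_permRel {m : ℕ} (p : Equiv.Perm (Fin m)) : IsWeakOrder (permRel p) :=
  ⟨fun a b => le_total (p a) (p b), fun _ _ _ => le_trans⟩

lemma perm_eq_of_le_iff_le {m : ℕ} {p q : Equiv.Perm (Fin m)}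
    (h : ∀ a b, p a ≤ p b ↔ q a ≤ q b) : p = q := by
  let e : Fin m ≃o Fin m :=
    { toEquiv := p.symm.trans q
      map_rel_iff' := fun {a b} => by
        have := h (p.symm a) (p.symm b)
        simpa using this.symm }
  have he : e = OrderIso.refl _ := Subsingleton.elim _ _
  ext a
  have := congrArg (fun f : Fin m ≃o Fin m => f (p a)) he
  have h2 : e (p a) = q a := by simp [e]
  rw [← h2, he]
  rfl

/-- The Lehmer code of a permutation. -/
def lehmer {m : ℕ} (p : Equiv.Perm (Fin m)) (j : Fin m) : Fin (j + 1) :=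
  ⟨((Finset.Iio j).filter fun i => p i < p j).card, by
    refine Nat.lt_succ_of_le ((Finset.card_filter_le _ _).trans ?_)
    rw [Fin.card_Iio]⟩

lemma lehmer_injective {m : ℕ} :
    Function.Injective (lehmer : Equiv.Perm (Fin m) → ∀ j : Fin m, Fin (j + 1)) := by
  intro p q hpq
  have key : ∀ b a : Fin m, a < b → (p a < p b ↔ q a < q b) := by
    intro b
    induction b using WellFoundedLT.induction with
    | ind b ih =>
      have hcmp : ∀ c d, c < b → d < b → p c < p d → q c < q d := by
        intro c d hc hd h
        rcases lt_trichotomy c d with hcd | rfl | hdc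
        · exact (ih d hd c hcd).1 h
        · exact absurd h (lt_irrefl _)
        · refine lt_of_le_of_ne (not_lt.1 fun h' => ?_) fun he => hdc.ne' (q.injective he)
          exact h.asymm ((ih c hc d hdc).2 h')
      have hcard : ((Finset.Iio b).filter fun i => p i < p b).card =
          ((Finset.Iio b).filter fun i => q i < q b).card :=
        congrArg Fin.val (congrFun hpq b)
      -- Both sets are initial segments for the common order on the labels below `b`, so equal
      -- cardinality makes them equal.
      have hset : (Finset.Iio b).filter (fun i => p i < p b) =
          (Finset.Iio b).filter fun i => q i < q b := by
        by_cases hsub : (Finset.Iio b).filter (fun i => p i < p b) ⊆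
            (Finset.Iio b).filter fun i => q i < q b
        · exact Finset.eq_of_subset_of_card_le hsub hcard.ge
        · obtain ⟨c, hc, hc'⟩ := Finset.not_subset.1 hsub
          symm
          refine Finset.eq_of_subset_of_card_le (fun d hd => ?_) hcard.le
          by_contra hd'
          simp only [Finset.mem_filter, Finset.mem_Iio, not_and] at hc hc' hd hd'
          have h1 : p b < p d := lt_of_le_of_ne (not_lt.1 (hd' hd.1)) fun he =>
            hd.1.ne' (p.injective he)
          exact hc' hc.1 ((hcmp c d hc.1 hd.1 (hc.2.trans h1)).trans hd.2)
      intro a ha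
      have := Finset.ext_iff.1 hset a
      simpa [ha] using this
  refine perm_eq_of_le_iff_le fun a b => ?_
  rw [← not_lt, ← not_lt, not_iff_not]
  rcases lt_trichotomy a b with hab | rfl | hba
  · have := key b a hab
    have h1 : p a ≠ p b := fun h => hab.ne (p.injective h)
    have h2 : q a ≠ q b := fun h => hab.ne (q.injective h)
    constructor
    · intro h
      exact lt_of_le_of_ne (not_lt.1 fun h' => h.asymm (this.2 h')) h2.symm
    · intro h
      exact lt_of_le_of_ne (not_lt.1 fun h' => h.asymm (this.1 h')) h1.symm
  · simp
  · exact key a b hba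

lemma lehmer_bijective {m : ℕ} :
    Function.Bijective (lehmer : Equiv.Perm (Fin m) → ∀ j : Fin m, Fin (j + 1)) := by
  rw [Fintype.bijective_iff_injective_and_card]
  refine ⟨lehmer_injective, ?_⟩
  rw [Fintype.card_perm, Fintype.card_pi, Fintype.card_fin]
  simp only [Fintype.card_fin]
  rw [Fin.prod_univ_eq_prod_range (fun j => j + 1), Finset.prod_range_add_one_eq_factorial]

/-- A label is a prefix minimum exactly when no smaller label precedes it, that is, when its Lehmer
entry is zero. The entries being independent, the generating function factors. -/
lemma numRecords_permRel {m : ℕ} (p : Equiv.Perm (Fin m)) :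
    numRecords (permRel p) = (Finset.univ.filter fun j => lehmer p j = 0).card := by
  rw [numRecords]
  congr 1
  ext j
  have hw := isWeakOrder_permRel p
  have h1 : j ∈ Finset.univ.image (prefixMin (permRel p)) ↔ prefixMin (permRel p) j = j := by
    simp only [Finset.mem_image, Finset.mem_univ, true_and]
    constructor
    · rintro ⟨a, rfl⟩
      exact hw.prefixMin_prefixMin a
    · intro h
      exact ⟨j, h⟩
  rw [h1]
  simp only [Finset.mem_filter, Finset.mem_univ, true_and, lehmer, Fin.ext_iff, Fin.val_zero,
    Finset.card_eq_zero, Finset.filter_eq_empty_iff, Finset.mem_Iio]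
  constructor
  · intro h i hi hlt
    have := prefixMin_le (r := permRel p) (a := j) (b := i) hlt.le
    rw [Fin.le_def, h] at this
    exact absurd hi (not_lt.2 this)
  · intro h
    refine Fin.ext_iff.1 (le_antisymm (prefixMin_le_self _ _) (le_prefixMin hw.refl fun b hb => ?_))
    by_contra hlt
    push Not at hlt
    exact h hlt (lt_of_le_of_ne hb fun he => hlt.ne (p.injective he))

open Polynomial in
/-- The generating function of the number of records is the rising factorial. -/
theorem sum_X_pow_numRecords (m : ℕ) :
    ∑ p : Equiv.Perm (Fin m), (X : ℕ[X]) ^ numRecords (permRel p) =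
      ∏ j : Fin m, (X + (j : ℕ[X])) := by
  have h1 : ∀ p : Equiv.Perm (Fin m), (X : ℕ[X]) ^ numRecords (permRel p) =
      ∏ j, if lehmer p j = 0 then X else 1 := by
    intro p
    rw [numRecords_permRel, Finset.prod_ite, Finset.prod_const, Finset.prod_const_one, mul_one]
  simp only [h1]
  rw [lehmer_bijective.sum_comp
    (fun c : ∀ j : Fin m, Fin (j + 1) => ∏ j, if c j = 0 then (X : ℕ[X]) else 1)]
  refine (Fintype.prod_sum fun (j : Fin m) (l : Fin (j + 1)) =>
    if l = 0 then (X : ℕ[X]) else 1).symm.trans ?_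
  refine Finset.prod_congr rfl fun j _ => ?_
  rw [Fin.sum_univ_succ]
  simp [Fin.succ_ne_zero]

open Polynomial in
lemma card_fiber_eq_of_sum_X_pow_eq {A B : Type*} [Fintype A] [Fintype B] (f : A → ℕ) (g : B → ℕ)
    (h : ∑ a, (X : ℕ[X]) ^ f a = ∑ b, X ^ g b) (k : ℕ) :
    Nat.card {a // f a = k} = Nat.card {b // g b = k} := by
  have := congrArg (fun P => P.coeff k) h
  simp only [finsetSum_coeff, coeff_X_pow, Finset.sum_boole, Nat.cast_id] at this
  rw [Nat.card_eq_fintype_card, Nat.card_eq_fintype_card, Fintype.card_subtype,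
    Fintype.card_subtype]
  simpa only [eq_comm] using this

theorem card_numRecords_eq_stirlingFst (m k : ℕ) :
    Nat.card {p : Equiv.Perm (Fin m) // numRecords (permRel p) = k} = stirlingFst m k :=
  card_fiber_eq_of_sum_X_pow_eq _ numCycles
    ((sum_X_pow_numRecords m).trans (sum_X_pow_numCycles m).symm) k

lemma stirlingFst_eq_zero_of_lt {m k : ℕ} (h : m < k) : stirlingFst m k = 0 := by
  rw [← card_numRecords_eq_stirlingFst, Nat.card_eq_zero]
  left
  refine ⟨fun p => ?_⟩
  have : numRecords (permRel p.1) ≤ m := by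
    simpa [numRecords] using Finset.card_image_le (s := Finset.univ) (f := prefixMin (permRel p.1))
  omega

end Records

/-! ### Counting weak orders by tie classes and records -/

section WeakOrders

variable {n : ℕ}

/-- The type of weak orders. -/
abbrev WeakOrder (n : ℕ) : Type := {r : Fin n → Fin n → Prop // IsWeakOrder r}

/-- The set partition into the equivalence classes of a weak order. -/
def WeakOrder.classes (r : WeakOrder n) : Finpartition (Finset.univ : Finset (Fin n)) :=
  Finpartition.ofSetoid
    { r := fun a b => r.1 a b ∧ r.1 b a
      iseqv := ⟨fun a => ⟨r.2.refl a, r.2.refl a⟩, fun h => ⟨h.2, h.1⟩,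
        fun h h' => ⟨r.2.trans _ _ _ h.1 h'.1, r.2.trans _ _ _ h'.2 h.2⟩⟩ }

lemma mem_part_iff_part_eq (P : Finpartition (Finset.univ : Finset (Fin n))) (a b : Fin n) :
    b ∈ P.part a ↔ P.part a = P.part b := by
  rw [← P.part_eq_iff_mem (P.part_mem.2 (Finset.mem_univ a)), eq_comm]

lemma WeakOrder.classes_eq_iff (r : WeakOrder n)
    (P : Finpartition (Finset.univ : Finset (Fin n))) :
    r.classes = P ↔ ∀ a b, (r.1 a b ∧ r.1 b a) ↔ P.part a = P.part b := by
  have hc : ∀ a b, (r.1 a b ∧ r.1 b a) ↔ b ∈ r.classes.part a := fun a b => by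
    rw [classes, Finpartition.mem_part_ofSetoid_iff_rel]
    rfl
  constructor
  · rintro rfl a b
    rw [hc, mem_part_iff_part_eq]
  · intro h
    apply Finpartition.ext
    rw [eq_image_part, eq_image_part]
    congr 1
    funext a
    ext b
    rw [← hc, h, mem_part_iff_part_eq]

/-- Enumeration of the blocks of a set partition by increasing least elements. -/
lemma exists_block_enumeration (P : Finpartition (Finset.univ : Finset (Fin n))) :
    ∃ (t : Fin n → Fin P.parts.card) (μ : Fin P.parts.card → Fin n), StrictMono μ ∧
      (∀ j, t (μ j) = j) ∧ (∀ a, μ (t a) ≤ a) ∧ ∀ a b, t a = t b ↔ P.part a = P.part b := by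
  have hself : ∀ a, a ∈ P.part a := fun a => P.mem_part_self.2 (Finset.mem_univ a)
  set m : Fin n → Fin n := fun a => (P.part a).min' ⟨a, hself a⟩ with hm
  have hmem : ∀ a, m a ∈ P.part a := fun a => Finset.min'_mem _ _
  have hpart : ∀ a, P.part a = P.part (m a) := fun a => (mem_part_iff_part_eq P _ _).1 (hmem a)
  have hcongr : ∀ a b, P.part a = P.part b → m a = m b := by
    intro a b h
    simp only [hm, h]
  have hiff : ∀ a b, m a = m b ↔ P.part a = P.part b := fun a b =>
    ⟨fun h => by rw [hpart a, h, ← hpart b], hcongr a b⟩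
  have hcard : (Finset.univ.image m).card = P.parts.card := by
    rw [eq_image_part]
    exact card_image_eq_card_image _ _ _ fun a _ b _ => hiff a b
  set e := (Finset.univ.image m).orderIsoOfFin hcard with he
  have hmD : ∀ a, m a ∈ Finset.univ.image m := fun a => Finset.mem_image_of_mem _ (Finset.mem_univ a)
  refine ⟨fun a => e.symm ⟨m a, hmD a⟩, fun j => (e j : Fin n), fun i j hij => e.strictMono hij,
    fun j => ?_, fun a => ?_, fun a b => ?_⟩
  · have hj : m (e j) = e j := by
      obtain ⟨b, -, hb⟩ := Finset.mem_image.1 (e j).2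
      rw [← hb]
      exact hcongr _ _ (hpart b).symm
    rw [OrderIso.symm_apply_eq]
    exact Subtype.ext hj
  · simp only [OrderIso.apply_symm_apply]
    exact Finset.min'_le _ _ (hself a)
  · rw [e.symm.injective.eq_iff, Subtype.mk_eq_mk, hiff]

/-- A weak order with tie classes `P` is a linear order on the blocks. Numbering blocks by their
least elements turns records of labels into records of a permutation. -/
theorem card_weakOrder_of_classes (P : Finpartition (Finset.univ : Finset (Fin n))) (k : ℕ) :
    Nat.card {r : WeakOrder n // r.classes = P ∧ numRecords r.1 = k} =
      stirlingFst P.parts.card k := by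
  obtain ⟨t, μ, hμ, htμ, hμt, ht⟩ := exists_block_enumeration P
  set R : Equiv.Perm (Fin P.parts.card) → WeakOrder n := fun p =>
    ⟨fun a b => permRel p (t a) (t b), fun a b => (isWeakOrder_permRel p).total _ _,
      fun a b c => (isWeakOrder_permRel p).trans _ _ _⟩ with hR
  have hrec : ∀ p, numRecords (R p).1 = numRecords (permRel p) := by
    intro p
    have hw := isWeakOrder_permRel p
    have hpm : ∀ a, prefixMin (R p).1 a = μ (prefixMin (permRel p) (t a)) := by
      intro a
      refine le_antisymm (prefixMin_le ?_) (le_prefixMin (R p).2.refl fun b hb => ?_)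
      · simp only [hR, htμ]
        exact prefixMin_rel hw.refl _
      · exact (hμ.monotone (prefixMin_le hb)).trans (hμt b)
    rw [numRecords, numRecords, ← Finset.card_image_of_injective _ hμ.injective]
    congr 1
    ext b
    simp only [Finset.mem_image, Finset.mem_univ, true_and, hpm, exists_exists_eq_and]
    constructor
    · rintro ⟨a, rfl⟩
      exact ⟨t a, rfl⟩
    · rintro ⟨j, rfl⟩
      exact ⟨μ j, by rw [htμ]⟩
  have hcl : ∀ p, (R p).classes = P := by
    intro p
    rw [WeakOrder.classes_eq_iff]
    intro a b
    rw [← ht]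
    exact ⟨fun h => p.injective (le_antisymm h.1 h.2), fun h => by
      simp only [hR, permRel, h]; exact ⟨le_rfl, le_rfl⟩⟩
  rw [← card_numRecords_eq_stirlingFst]
  symm
  refine Nat.card_congr (Equiv.ofBijective (fun p => ⟨R p.1, hcl _, (hrec _).trans p.2⟩) ⟨?_, ?_⟩)
  · rintro ⟨p, hp⟩ ⟨q, hq⟩ h
    refine Subtype.ext (perm_eq_of_le_iff_le fun i j => ?_)
    have h1 : (R p).1 = (R q).1 := congrArg (fun r => r.1.1) h
    have h2 := congrFun (congrFun h1 (μ i)) (μ j)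
    simp only [hR, permRel, htμ] at h2
    exact h2 ▸ Iff.rfl
  · rintro ⟨r, hrP, hrk⟩
    rw [WeakOrder.classes_eq_iff] at hrP
    set r' : Fin P.parts.card → Fin P.parts.card → Prop := fun i j => r.1 (μ i) (μ j) with hr'
    have hw : IsWeakOrder r' := ⟨fun _ _ => r.2.total _ _, fun _ _ _ => r.2.trans _ _ _⟩
    have hlev : ∀ i j, level r' i ≤ level r' j ↔ r' i j := fun i j =>
      level_le_iff hw.refl hw.trans (hw.total i j)
    have hpos : ∀ i, 0 < level r' i := fun i => Finset.card_pos.2 ⟨i, by simp [hw.refl]⟩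
    have hlt : ∀ i, level r' i ≤ P.parts.card := fun i => by
      simpa only [level, Fintype.card_fin] using Finset.card_le_univ (Finset.univ.filter (r' · i))
    -- Levels start at 1, since each element lies weakly below itself; the shift lands them in
    -- `Fin`.
    set f : Fin P.parts.card → Fin P.parts.card := fun i =>
      ⟨level r' i - 1, by have := hpos i; have := hlt i; omega⟩ with hf
    have hfle : ∀ i j, f i ≤ f j ↔ r' i j := by
      intro i j
      rw [← hlev, hf, Fin.le_def]
      have := hpos i
      have := hpos j
      simp only
      omega
    have hinj : Function.Injective f := by
      intro i j hij
      have h1 := (hfle i j).1 hij.le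
      have h2 := (hfle j i).1 hij.ge
      have := (hrP _ _).1 ⟨h1, h2⟩
      rwa [← ht, htμ, htμ] at this
    set p := Equiv.ofBijective f (Finite.injective_iff_bijective.1 hinj) with hp
    have hpr : R p = r := by
      apply Subtype.ext
      funext a b
      -- Each label is tied with the representative of its block.
      have hsame : ∀ a, r.1 a (μ (t a)) ∧ r.1 (μ (t a)) a := fun a => by
        rw [hrP, ← ht, htμ]
      have h1 : permRel p (t a) (t b) ↔ r' (t a) (t b) := hfle _ _
      simp only [hR, h1, eq_iff_iff]
      exact ⟨fun h => r.2.trans _ _ _ (hsame a).1 (r.2.trans _ _ _ h (hsame b).2),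
        fun h => r.2.trans _ _ _ (hsame a).2 (r.2.trans _ _ _ h (hsame b).1)⟩
    exact ⟨⟨p, by rw [← hrec, hpr, hrk]⟩, Subtype.ext hpr⟩

theorem card_weakOrder (k : ℕ) :
    Nat.card {r : WeakOrder n // numRecords r.1 = k} =
      ∑ i ∈ Finset.Icc k n, stirlingSnd n i * stirlingFst i k := by
  have h1 : Nat.card {r : WeakOrder n // numRecords r.1 = k} =
      ∑ P : Finpartition (Finset.univ : Finset (Fin n)), stirlingFst P.parts.card k := by
    rw [← Nat.card_congr (Equiv.sigmaFiberEquiv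
      fun r : {r : WeakOrder n // numRecords r.1 = k} => r.1.classes), Nat.card_sigma]
    refine Finset.sum_congr rfl fun P _ => ?_
    rw [← card_weakOrder_of_classes]
    exact Nat.card_congr ((Equiv.subtypeSubtypeEquivSubtypeInter
      (fun r : WeakOrder n => numRecords r.1 = k) (fun r => r.classes = P)).trans
      (Equiv.subtypeEquivRight fun r => and_comm))
  have hle : ∀ P : Finpartition (Finset.univ : Finset (Fin n)), P.parts.card ∈ Finset.range (n + 1) :=
    fun P => Finset.mem_range_succ_iff.2 (by simpa using P.card_parts_le_card)
  rw [h1, ← Finset.sum_fiberwise_of_maps_to (fun P _ => hle P)]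
  symm
  refine Finset.sum_subset_zero_on_sdiff (fun i hi => ?_) (fun i hi => ?_) (fun i _ => ?_)
  · rw [Finset.mem_Icc] at hi
    rw [Finset.mem_range]
    omega
  -- The indices below `k` contribute nothing: fewer than `k` blocks cannot have `k` records.
  · rw [Finset.mem_sdiff, Finset.mem_range, Finset.mem_Icc] at hi
    refine Finset.sum_eq_zero fun P hP => ?_
    rw [(Finset.mem_filter.1 hP).2, stirlingFst_eq_zero_of_lt (by omega)]
  · rw [Finset.sum_congr rfl (g := fun _ => stirlingFst i k) fun P hP => by
      rw [(Finset.mem_filter.1 hP).2], Finset.sum_const, smul_eq_mul, stirlingSnd,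
      Nat.card_eq_fintype_card, Fintype.card_subtype]

lemma eq_bot_of_card_parts (P : Finpartition (Finset.univ : Finset (Fin n)))
    (h : P.parts.card = n) : P = ⊥ := by
  have hone : ∀ J ∈ P.parts, J.card = 1 := by
    have hsum : ∑ J ∈ P.parts, J.card = ∑ J ∈ P.parts, 1 := by
      rw [P.sum_card_parts]
      simp [h]
    have := (Finset.sum_eq_sum_iff_of_le (s := P.parts) (f := fun _ => 1) (g := fun J => J.card)
      fun J hJ => Finset.card_pos.2 (P.nonempty_of_mem_parts hJ)).1 hsum.symm
    exact fun J hJ => (this J hJ).symm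
  refine bot_unique fun J hJ => ?_
  obtain ⟨a, rfl⟩ := Finset.card_eq_one.1 (hone J hJ)
  exact ⟨{a}, Finpartition.mem_bot_iff.2 ⟨a, Finset.mem_univ a, rfl⟩, le_rfl⟩

lemma stirlingSnd_self (n : ℕ) : stirlingSnd n n = 1 := by
  rw [stirlingSnd, Nat.card_eq_one_iff_unique]
  exact ⟨⟨fun P Q => Subtype.ext ((eq_bot_of_card_parts P.1 P.2).trans
    (eq_bot_of_card_parts Q.1 Q.2).symm)⟩, ⟨⊥, by simp⟩⟩

/-- The absence of ties means that the partition into tie classes is the discrete one, `⊥`, with `n`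
blocks. -/
theorem card_antisymm_weakOrder (k : ℕ) :
    Nat.card {r : WeakOrder n // (∀ a b, r.1 a b → r.1 b a → a = b) ∧ numRecords r.1 = k} =
      stirlingFst n k := by
  have h := card_weakOrder_of_classes (⊥ : Finpartition (Finset.univ : Finset (Fin n))) k
  rw [Finpartition.card_bot, Finset.card_univ, Fintype.card_fin] at h
  rw [← h]
  refine Nat.card_congr (Equiv.subtypeEquivRight fun r => and_congr_left fun _ => ?_)
  rw [WeakOrder.classes_eq_iff]
  have hpart : ∀ a, (⊥ : Finpartition (Finset.univ : Finset (Fin n))).part a = {a} := fun a =>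
    Finpartition.part_eq_of_mem _ (Finpartition.mem_bot_iff.2 ⟨a, Finset.mem_univ a, rfl⟩)
      (Finset.mem_singleton_self a)
  simp only [hpart, Finset.singleton_inj]
  exact ⟨fun h a b => ⟨fun h' => h a b h'.1 h'.2, fun h' => h' ▸ ⟨r.2.refl a, r.2.refl a⟩⟩,
    fun h a b h₁ h₂ => (h a b).1 ⟨h₁, h₂⟩⟩

end WeakOrders

/-! ### Gradings and dimensions from the two bases -/

section Assembly

lemma isInternal_span_fibers {C V : Type*} [AddCommGroup V] [Module ℂ V] {v : C → V}
    (hv : LinearIndependent ℂ v) (hs : Submodule.span ℂ (Set.range v) = ⊤) (d : C → ℕ)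
    (W : ℕ → Submodule ℂ V) (hW : ∀ k, W k = Submodule.span ℂ (v '' {c | d c = k})) :
    DirectSum.IsInternal W := by
  refine DirectSum.isInternal_submodule_of_iSupIndep_of_iSup_eq_top ?_ ?_
  · intro k
    have : ⨆ j, ⨆ (_ : j ≠ k), W j = Submodule.span ℂ (v '' {c | d c ≠ k}) := by
      simp only [hW, ← Submodule.span_iUnion, ← Set.image_iUnion]
      congr 2
      ext c
      simp
    rw [this, hW]
    exact hv.disjoint_span_image (Set.disjoint_left.2 fun c h h' => h' h)
  · rw [funext hW, ← Submodule.span_iUnion, ← Set.image_iUnion, ← hs, ← Set.image_univ]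
    congr 2
    ext c
    simp

lemma rank_span_fiber {C V : Type*} [Finite C] [AddCommGroup V] [Module ℂ V] {v : C → V}
    (hv : LinearIndependent ℂ v) (d : C → ℕ) (k : ℕ) :
    Module.rank ℂ (Submodule.span ℂ (v '' {c | d c = k})) = (Nat.card {c // d c = k} : ℕ) := by
  have h := hv.comp (Subtype.val : {c // d c = k} → C) Subtype.val_injective
  have hr : v '' {c | d c = k} = Set.range (v ∘ (Subtype.val : {c // d c = k} → C)) := by
    rw [Set.range_comp, Subtype.range_coe_subtype]
  rw [hr, rank_span h, ← Nat.cast_card, Nat.card_range_of_injective h.injective]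

variable {n : ℕ}

lemma degreeComponent_eq (k : ℕ) : degreeComponent n k = Submodule.span ℂ
    (coneVector '' {c : StandardComposite n | c.1.numParts = k}) := by
  rw [degreeComponent]
  congr 1
  ext f
  constructor
  · rintro ⟨c, hc, hk, hf⟩
    exact ⟨⟨c, hc⟩, hk, Subtype.ext hf.symm⟩
  · rintro ⟨c, hk, rfl⟩
    exact ⟨c.1, c.2, hk, rfl⟩

lemma pointedDegreeComponent_eq (k : ℕ) : pointedDegreeComponent n k = Submodule.span ℂ
    (pointedVector '' {c : PointedComposite n | c.1.1.numParts = k}) := by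
  rw [pointedDegreeComponent]
  congr 1
  ext g
  constructor
  · rintro ⟨f, c, hc, hk, hp, hf, rfl⟩
    refine ⟨⟨⟨c, hc⟩, hp⟩, hk, ?_⟩
    rw [pointedVector, show coneVector ⟨c, hc⟩ = f from Subtype.ext hf.symm]
  · rintro ⟨c, hk, rfl⟩
    exact ⟨coneVector c.1, c.1.1, c.1.2, hk, c.2, rfl, rfl⟩

lemma numParts_eq_numRecords (c : StandardComposite n) :
    c.1.numParts = numRecords (weakOrderEquiv n c).1 := by
  rw [weakOrderEquiv_apply, numRecords, c.isStandardRel.prefixMin_concat,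
    c.1.numParts_eq c.isStandardRel]

lemma card_standardComposite (k : ℕ) : Nat.card {c : StandardComposite n // c.1.numParts = k} =
    ∑ i ∈ Finset.Icc k n, stirlingSnd n i * stirlingFst i k := by
  rw [← card_weakOrder]
  exact Nat.card_congr ((weakOrderEquiv n).subtypeEquiv fun c => by rw [numParts_eq_numRecords])

lemma card_pointedComposite (k : ℕ) :
    Nat.card {c : PointedComposite n // c.1.1.numParts = k} = stirlingFst n k := by
  rw [← card_antisymm_weakOrder]
  refine Nat.card_congr ((Equiv.subtypeSubtypeEquivSubtypeInter
    (fun c : StandardComposite n => IsPointed c.1.cone) (fun c => c.1.numParts = k)).trans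
    ((weakOrderEquiv n).subtypeEquiv fun c => ?_))
  rw [numParts_eq_numRecords, c.1.isPointed_cone_iff, ← c.isStandardRel.concat_antisymm_iff]
  rfl

end Assembly

end Plates

end

theorem corollary4p8 (n : ℕ) (hn : 1 ≤ n) :
    (DirectSum.IsInternal (fun k : ℕ => Plates.degreeComponent n k) ∧
      ∀ k : ℕ,
        Module.rank ℂ (Plates.degreeComponent n k) =
          ((Nat.card {c : Plates.CompositeSetPartition n // c.IsStandard ∧ c.numParts = k} : ℕ) :
            Cardinal) ∧
        Nat.card {c : Plates.CompositeSetPartition n // c.IsStandard ∧ c.numParts = k} =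
          ∑ i ∈ Finset.Icc k n, Plates.stirlingSnd n i * Plates.stirlingFst i k) ∧
    (DirectSum.IsInternal (fun k : ℕ => Plates.pointedDegreeComponent n k) ∧
      ∀ k : ℕ,
        Module.rank ℂ (Plates.pointedDegreeComponent n k) =
          ((Plates.stirlingSnd n n * Plates.stirlingFst n k : ℕ) : Cardinal) ∧
        Plates.stirlingSnd n n * Plates.stirlingFst n k = Plates.stirlingFst n k) := by
  refine ⟨⟨?_, fun k => ⟨?_, ?_⟩⟩, ?_, fun k => ⟨?_, ?_⟩⟩
  · exact Plates.isInternal_span_fibers Plates.linearIndependent_coneVector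
      Plates.span_coneVector (fun c => c.1.numParts) _ Plates.degreeComponent_eq
  · rw [Plates.degreeComponent_eq, Plates.rank_span_fiber Plates.linearIndependent_coneVector
      (fun c => c.1.numParts)]
    exact congrArg _ (Nat.card_congr (Equiv.subtypeSubtypeEquivSubtypeInter
      (fun c : Plates.CompositeSetPartition n => c.IsStandard) (fun c => c.numParts = k)))
  · rw [← Plates.card_standardComposite]
    exact (Nat.card_congr (Equiv.subtypeSubtypeEquivSubtypeInter
      (fun c : Plates.CompositeSetPartition n => c.IsStandard) (fun c => c.numParts = k))).symm
  · exact Plates.isInternal_span_fibers Plates.linearIndependent_pointedVector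
      Plates.span_pointedVector (fun c => c.1.1.numParts) _ Plates.pointedDegreeComponent_eq
  · rw [Plates.pointedDegreeComponent_eq, Plates.rank_span_fiber
      Plates.linearIndependent_pointedVector (fun c => c.1.1.numParts),
      Plates.card_pointedComposite, Plates.stirlingSnd_self, one_mul]
  · rw [Plates.stirlingSnd_self, one_mul]
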